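/- **Theorem 3.18.** Let $K$ be a field and let $E=(E^0,E^1,r,s)$ be a row-finite directed graph, i.e. $s^{-1}(v)$ is finite for every $v\in E^0$ (the sets $E^0$, $E^1$ may be infinite). A path is a finite sequence of edges $e_1\cdots e_n$ with $r(e_i)=s(e_{i+1})$; vertices are the paths of length $0$. Let $L_K(E)$ be the Leavitt path algebra: the associative, not necessarily unital $K$-algebra generated by the elements $v\in E^0$ and $e,e^*$ ($e\in E^1$), with relations $vw=\delta_{v,w}v$; $s(e)e=er(e)=e$; $r(e)e^*=e^*s(e)=e^*$; $e^*f=\delta_{e,f}\,r(e)$; and $v=\sum_{s(e)=v}ee^*$ for every $v$ that emits a nonzero finite number of edges. For a path $\alpha=e_1\cdots e_n$ put $\alpha^*=e_n^*\cdots e_1^*$ (and $v^*=v$ for a vertex $v$). The component $L_K(E)_n$ ($n\in\mathbb Z$) is the span of all $\alpha\beta^*$ with $\alpha,\beta$ paths and $\mathrm{length}(\alpha)-\mathrm{length}(\beta)=n$. Write $v\ge w$ if there is a path from $v$ to $w$, and $T(v)=\{w: v\ge w\}$. A bifurcation is a vertex emitting at least two edges. A cycle is a path $c=e_1\cdots e_n$,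 $n\ge 1$, with $s(e_1)=r(e_n)$ and $s(e_i)\neq s(e_j)$ for $i\ne j$; $c^0$ is its set of vertices; an exit of $c$ is an edge $f$ with $s(f)=s(e_i)$ and $f\ne e_i$ for some $i$. A cycle $c$ is extreme if it has an exit and every path starting at a vertex of $c^0$ can be prolonged to a path ending in $c^0$. Let $P_l$ be the set of vertices $v$ such that $T(v)$ contains no bifurcation and no vertex of a cycle, $P_c$ the set of vertices in cycles without exits, $P_{ec}$ the set of vertices in extreme cycles, and $P=P_l\cup P_c\cup P_{ec}$. For $u,v\in E^0$ write $u\sim^1 v$ if $u=v$, or if ($u\ge v$ or $v\ge u$) and $T(u)\cup T(v)$ contains no bifurcation, or if there are a cycle $c$ and $w\in c^0$ with $w\ge u$ and $w\ge v$. Let $\sim$ be the transitive closure of $\sim^1$ (an equivalence relation on $E^0$) and $[v]\subseteq E^0$ the class of $v$. Let $\overline{[v]}=\bigcup_{n\ge 0}\Lambda_n$ be its saturated closure, where $\Lambda_0=[v]$ and $\Lambda_{n+1}=\Lambda_n\cup\{x\in E^0 : 0<|s^{-1}(x)|<\infty,\ r(s^{-1}(x))\subseteq\Lambda_n\}$.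 For $H\subseteq E^0$ let $F_E(H)$ be the set of paths $e_1\cdots e_n$, $n\ge 1$, with $s(e_1)\notin H$, $r(e_i)\notin H$ for $i<n$, and $r(e_n)\in H$. Let $P_f$ be the set of $v\in P$ such that $\overline{[v]}$ and $F_E(\overline{[v]})$ are both finite, let $X=\{[v] : v\in P\}$, and let $X_f$ be the set of those classes in $X$ all of whose elements that lie in $P$ belong to $P_f$. For $[v]\in X_f$ put $$a_{[v]}=\sum_{u\in\overline{[v]}}u+\sum_{\alpha\in F_E(\overline{[v]})}\alpha\alpha^*\ \in L_K(E).$$ Then the elements $a_{[v]}$, $[v]\in X_f$, are pairwise distinct and form a $K$-basis of the zero component $Z(L_K(E))\cap L_K(E)_0$ of the center $Z(L_K(E))=\{x : xa=ax \text{ for all } a\in L_K(E)\}$ of $L_K(E)$. -/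

import Mathlib

noncomputable section

universe u v w

/-- A directed graph with vertex set `V` and edge set `Ed`, with source map `s` and range map `r`
(loops and parallel edges are allowed, both sets may be infinite). -/
structure DirectedGraph (V : Type u) (Ed : Type v) where
  /-- the source of an edge -/
  s : Ed → V
  /-- the range of an edge -/
  r : Ed → V

namespace DirectedGraph

variable {V : Type u} {Ed : Type v} (E : DirectedGraph V Ed)

/-- Every vertex emits finitely many edges. -/
def RowFinite : Prop := ∀ x : V, {e : Ed | E.s e = x}.Finite

/-- The list of edges `p` is a path from `x` to `y`; the empty list is the path of length zero
at a vertex. -/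
def IsPath : V → List Ed → V → Prop
  | x, [], y => x = y
  | x, e :: p, y => E.s e = x ∧ IsPath (E.r e) p y

/-- The finite paths of the graph, vertices being the paths of length `0`. -/
@[ext] structure Path where
  /-- the source of the path -/
  source : V
  /-- the list of edges, in order -/
  edges : List Ed
  /-- the range of the path -/
  range : V
  isPath : E.IsPath source edges range

variable {E} in
/-- The length of a path. -/
def Path.length (α : E.Path) : ℕ := α.edges.length

/-- `x ≥ y`: there is a path from `x` to `y`. -/
def Connects (x y : V) : Prop := ∃ α : E.Path, α.source = x ∧ α.range = y

/-- The tree `T(x)` of a vertex: all vertices to which it connects. -/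
def tree (x : V) : Set V := {y | E.Connects x y}

/-- A bifurcation is a vertex that emits at least two edges. -/
def IsBifurcation (x : V) : Prop := ∃ e f : Ed, e ≠ f ∧ E.s e = x ∧ E.s f = x

/-- A cycle: a closed path `e₁ … eₙ` with `n ≥ 1` whose edges have pairwise distinct sources. -/
def IsCycle (c : List Ed) : Prop :=
  c ≠ [] ∧ (∃ x, E.IsPath x c x) ∧ (c.map E.s).Nodup

/-- The vertices of a (nonempty) list of edges. -/
def vertices (c : List Ed) : Set V := {x | ∃ e ∈ c, E.s e = x ∨ E.r e = x}

/-- `c` has an exit: some edge starts at the source of an edge of `c` and differs from it. -/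
def HasExit (c : List Ed) : Prop := ∃ f : Ed, ∃ e ∈ c, E.s f = E.s e ∧ f ≠ e

/-- An extreme cycle: a cycle with exits such that every path starting at a vertex of the cycle
can be continued to a path that ends in the cycle. -/
def IsExtremeCycle (c : List Ed) : Prop :=
  E.IsCycle c ∧ E.HasExit c ∧
    ∀ α : E.Path, α.source ∈ E.vertices c → ∃ y ∈ E.vertices c, E.Connects α.range y

/-- `P_l`, the line points: the tree of the vertex contains neither bifurcations nor vertices
of cycles. -/
def Pl : Set V :=
  {x | ∀ y ∈ E.tree x, ¬ E.IsBifurcation y ∧ ¬ ∃ c, E.IsCycle c ∧ y ∈ E.vertices c}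

/-- `P_c`: the vertices in cycles without exits. -/
def Pc : Set V := {x | ∃ c, E.IsCycle c ∧ ¬ E.HasExit c ∧ x ∈ E.vertices c}

/-- `P_ec`: the vertices in extreme cycles. -/
def Pec : Set V := {x | ∃ c, E.IsExtremeCycle c ∧ x ∈ E.vertices c}

/-- `P = P_l ∪ P_c ∪ P_ec`. -/
def P : Set V := E.Pl ∪ E.Pc ∪ E.Pec

/-- The relation `∼¹` on vertices. -/
def Rel₁ (x y : V) : Prop :=
  x = y ∨
  ((E.Connects x y ∨ E.Connects y x) ∧ ∀ z ∈ E.tree x ∪ E.tree y, ¬ E.IsBifurcation z) ∨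
  ∃ c, E.IsCycle c ∧ ∃ z ∈ E.vertices c, E.Connects z x ∧ E.Connects z y

theorem Rel₁.symm {x y : V} (h : E.Rel₁ x y) : E.Rel₁ y x := by
  rcases h with h | ⟨h, h'⟩ | ⟨c, hc, z, hz, h, h'⟩
  · exact Or.inl h.symm
  · exact Or.inr (Or.inl ⟨h.symm, fun z hz => h' z hz.symm⟩)
  · exact Or.inr (Or.inr ⟨c, hc, z, hz, h', h⟩)

/-- The equivalence relation `∼` on vertices: the transitive closure of `∼¹`. -/
def equiv : Setoid V where
  r := Relation.TransGen E.Rel₁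
  iseqv :=
    { refl := fun _ => Relation.TransGen.single (Or.inl rfl)
      symm := fun h => by
        induction h with
        | single h => exact Relation.TransGen.single (Rel₁.symm E h)
        | tail _ h ih => exact Relation.TransGen.head (Rel₁.symm E h) ih
      trans := fun h h' => h.trans h' }

/-- The `∼`-classes of vertices. -/
abbrev Class := Quotient E.equiv

variable {E} in
/-- A `∼`-class as a set of vertices. -/
def Class.carrier (q : E.Class) : Set V := {x | (Quotient.mk E.equiv x) = q}

/-- The sets `Λₙ(X)`: in each step, add all vertices that emit a nonzero finite number of edges,
all of which end in the set already obtained. -/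
def satStep (X : Set V) : ℕ → Set V
  | 0 => X
  | n + 1 => satStep X n ∪
      {x | {e : Ed | E.s e = x}.Nonempty ∧ {e : Ed | E.s e = x}.Finite ∧
        ∀ e : Ed, E.s e = x → E.r e ∈ satStep X n}

/-- The saturated closure of a set of vertices. -/
def satClosure (X : Set V) : Set V := ⋃ n, E.satStep X n

/-- `F_E(H)`: the paths `e₁ … eₙ` of positive length with `s(e₁) ∉ H`, `r(eᵢ) ∉ H` for `i < n`
and `r(eₙ) ∈ H`. -/
def F (H : Set V) : Set E.Path :=
  {α | α.edges ≠ [] ∧ α.source ∉ H ∧ (∀ e ∈ α.edges.dropLast, E.r e ∉ H) ∧ α.range ∈ H}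

variable {E} in
/-- The saturated closure of a class. -/
def Class.closure (q : E.Class) : Set V := E.satClosure q.carrier

/-- `P_f`: the vertices `x ∈ P` such that the saturated closure of `[x]` and the set of paths
`F_E` of this closure are both finite. -/
def Pf : Set V :=
  {x | x ∈ E.P ∧ (Class.closure (Quotient.mk E.equiv x)).Finite ∧
    (E.F (Class.closure (Quotient.mk E.equiv x))).Finite}

/-- `X = P/∼`: the classes of the vertices of `P`. -/
def X : Set E.Class := {q | ∃ x ∈ E.P, Quotient.mk E.equiv x = q}

/-- `X_f`: the classes in `X` all of whose vertices in `P` belong to `P_f`. -/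
def Xf : Set E.Class := {q | q ∈ E.X ∧ ∀ x ∈ E.P, Quotient.mk E.equiv x = q → x ∈ E.Pf}

end DirectedGraph

namespace LeavittPath

variable (K : Type w) [Field K] {V : Type u} {Ed : Type v} (E : DirectedGraph V Ed)

/-- The generators of the Leavitt path algebra: vertices, edges and ghost edges. -/
inductive Gen (V : Type u) (Ed : Type v) : Type (max u v)
  | vertex (x : V) : Gen V Ed
  | edge (e : Ed) : Gen V Ed
  | ghost (e : Ed) : Gen V Ed

/-- The free associative non-unital `K`-algebra on the generators (the semigroup algebra of the
free semigroup). -/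
abbrev FreeAlg (V : Type u) (Ed : Type v) := MonoidAlgebra K (FreeSemigroup (Gen V Ed))

/-- A generator as an element of the free algebra. -/
def gen (g : Gen V Ed) : FreeAlg K V Ed := MonoidAlgebra.single (FreeSemigroup.of g) 1

/-- The defining relations (V), (E1), (E2), (CK1), (CK2). The last one is imposed at every vertex
that emits a finite nonzero number of edges, `S` being the set of these edges. -/
inductive Rel : FreeAlg K V Ed → FreeAlg K V Ed → Prop
  | vertex_self (x : V) : Rel (gen K (.vertex x) * gen K (.vertex x)) (gen K (.vertex x))
  | vertex_ne (x y : V) (h : x ≠ y) : Rel (gen K (.vertex x) * gen K (.vertex y)) 0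
  | source_edge (e : Ed) : Rel (gen K (.vertex (E.s e)) * gen K (.edge e)) (gen K (.edge e))
  | edge_range (e : Ed) : Rel (gen K (.edge e) * gen K (.vertex (E.r e))) (gen K (.edge e))
  | range_ghost (e : Ed) : Rel (gen K (.vertex (E.r e)) * gen K (.ghost e)) (gen K (.ghost e))
  | ghost_source (e : Ed) : Rel (gen K (.ghost e) * gen K (.vertex (E.s e))) (gen K (.ghost e))
  | ck1_self (e : Ed) : Rel (gen K (.ghost e) * gen K (.edge e)) (gen K (.vertex (E.r e)))
  | ck1_ne (e f : Ed) (h : e ≠ f) : Rel (gen K (.ghost e) * gen K (.edge f)) 0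
  | ck2 (x : V) (S : Finset Ed) (hS : ∀ e, e ∈ S ↔ E.s e = x) (hne : S.Nonempty) :
      Rel (∑ e ∈ S, gen K (.edge e) * gen K (.ghost e)) (gen K (.vertex x))

/-- The congruence of the free `K`-algebra generated by the scalar multiples of the defining
relations, i.e. congruence modulo the two-sided `K`-algebra ideal generated by the relations. -/
def con : RingCon (FreeAlg K V Ed) :=
  ringConGen fun a b => ∃ (k : K) (a' b' : FreeAlg K V Ed), Rel K E a' b' ∧ a = k • a' ∧ b = k • b'

theorem con_smul (k : K) {a b : FreeAlg K V Ed} (h : con K E a b) : con K E (k • a) (k • b) := by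
  change RingConGen.Rel _ a b at h
  change RingConGen.Rel _ _ _
  induction h with
  | of x y h =>
    obtain ⟨l, x', y', h, rfl, rfl⟩ := h
    exact .of _ _ ⟨k * l, x', y', h, smul_smul _ _ _, smul_smul _ _ _⟩
  | refl => exact .refl _
  | symm _ ih => exact .symm ih
  | trans _ _ ih ih' => exact .trans ih ih'
  | add _ _ ih ih' => rw [smul_add, smul_add]; exact .add ih ih'
  | mul _ h _ _ =>
    rename_i ih _
    rw [← smul_mul_assoc, ← smul_mul_assoc]; exact .mul ih h

end LeavittPath

/-- The Leavitt path algebra `L_K(E)`: the associative, not necessarily unital `K`-algebra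
generated by vertices, edges and ghost edges subject to the defining relations. -/
def LeavittPathAlgebra (K : Type w) [Field K] {V : Type u} {Ed : Type v}
    (E : DirectedGraph V Ed) : Type (max u v w) :=
  (LeavittPath.con K E).Quotient

namespace LeavittPathAlgebra

variable (K : Type w) [Field K] {V : Type u} {Ed : Type v} (E : DirectedGraph V Ed)

instance : NonUnitalRing (LeavittPathAlgebra K E) :=
  inferInstanceAs (NonUnitalRing (LeavittPath.con K E).Quotient)

/-- The quotient map from the free algebra. -/
def mk (a : LeavittPath.FreeAlg K V Ed) : LeavittPathAlgebra K E :=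
  ((a : (LeavittPath.con K E).Quotient))

theorem mk_surjective : Function.Surjective (mk K E) := Quotient.mk_surjective

instance : SMul K (LeavittPathAlgebra K E) :=
  ⟨fun k => Quotient.map (fun a => k • a) fun _ _ h => LeavittPath.con_smul K E k h⟩

instance : Module K (LeavittPathAlgebra K E) :=
  Function.Surjective.module K
    (⟨⟨mk K E, rfl⟩, fun _ _ => rfl⟩ : LeavittPath.FreeAlg K V Ed →+ LeavittPathAlgebra K E)
    (mk_surjective K E) (fun _ _ => rfl)

instance : IsScalarTower K (LeavittPathAlgebra K E) (LeavittPathAlgebra K E) :=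
  ⟨fun k x y => by
    obtain ⟨a, rfl⟩ := mk_surjective K E x
    obtain ⟨b, rfl⟩ := mk_surjective K E y
    exact congrArg (mk K E) (smul_mul_assoc k a b)⟩

instance : SMulCommClass K (LeavittPathAlgebra K E) (LeavittPathAlgebra K E) :=
  ⟨fun k x y => by
    obtain ⟨a, rfl⟩ := mk_surjective K E x
    obtain ⟨b, rfl⟩ := mk_surjective K E y
    exact congrArg (mk K E) (mul_smul_comm k a b).symm⟩

/-- A vertex as an element of `L_K(E)`. -/
def vertex (x : V) : LeavittPathAlgebra K E := mk K E (LeavittPath.gen K (.vertex x))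

/-- A (real) edge as an element of `L_K(E)`. -/
def edge (e : Ed) : LeavittPathAlgebra K E := mk K E (LeavittPath.gen K (.edge e))

/-- The ghost edge `e*` as an element of `L_K(E)`. -/
def ghostEdge (e : Ed) : LeavittPathAlgebra K E := mk K E (LeavittPath.gen K (.ghost e))

variable {E}

/-- A path `α = e₁ … eₙ` as the element `e₁ ⋯ eₙ r(eₙ) = e₁ ⋯ eₙ` of `L_K(E)`
(a vertex if `n = 0`). -/
def path (α : E.Path) : LeavittPathAlgebra K E :=
  α.edges.foldr (fun e a => edge K E e * a) (vertex K E α.range)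

/-- The element `α* = r(eₙ) eₙ* ⋯ e₁* = eₙ* ⋯ e₁*` of `L_K(E)` for a path `α = e₁ … eₙ`
(a vertex if `n = 0`). -/
def ghostPath (α : E.Path) : LeavittPathAlgebra K E :=
  α.edges.foldr (fun e a => a * ghostEdge K E e) (vertex K E α.range)

variable (E)

/-- The component of degree `n` of `L_K(E)`, spanned by the elements `αβ*` with
`length α - length β = n`. -/
def component (n : ℤ) : Submodule K (LeavittPathAlgebra K E) :=
  Submodule.span K {x | ∃ α β : E.Path, (α.length : ℤ) - (β.length : ℤ) = n ∧
    x = path K α * ghostPath K β}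

/-- The homogeneous component of degree `n` of the center of `L_K(E)`. -/
def centerComponent (n : ℤ) : Submodule K (LeavittPathAlgebra K E) :=
  (NonUnitalSubalgebra.center K (LeavittPathAlgebra K E)).toSubmodule ⊓ component K E n

variable {E}

/-- The element `a_[v] = ∑ u + ∑ αα*`, where `u` runs over the saturated closure of `[v]` and `α`
over `F_E` of this closure (both sets are finite if `[v] ∈ X_f`). -/
def classElement (q : E.Class) : LeavittPathAlgebra K E :=
  (∑ᶠ x ∈ q.closure, vertex K E x) + ∑ᶠ α ∈ E.F q.closure, path K α * ghostPath K α

end LeavittPathAlgebra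

end

/-! Let x be central of degree 0. For a path p from a to b, centrality and p*p = b give p*xp = xb.
Writing x as a combination of elements γδ* with |γ| = |δ|, each p*γδ*p is a scalar multiple of b
once p is at least as long as every γ, or b is a sink. Hence x acts as a scalar at the end of every
long or maximal path (`exists_scalar_of_long`). Such a scalar passes forward along edges because
xr(e) = e*xs(e)e. By (CK2) it also passes back to a vertex all of whose edges lead to the same
scalar.

Vertices on cycles end arbitrarily long paths, and below a vertex that sees no bifurcation there is
nothing to disagree. So x acts by one scalar on each class in X and on its saturated closure
(`scalar_of_mem_closure`). Since xv = 0 for all but finitely many vertices v, a nonzero scalar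
forces the closure and its set F_E to be finite, so the class lies in X_f (`mk_mem_Xf`).

Conversely, a_[v] is central, acts as 1 on [v] and as 0 on every other class in X. As vertices are
nonzero, this gives linear independence. For spanning, subtract from x the combination of the a_[v]
with the same scalars; the difference annihilates P. A central element of degree 0 that annihilates
P is zero (`eq_zero_of_mul_P`): a nonzero scalar at b would make T(b) finite, and a finite tree
meets P. -/

noncomputable section

universe u v w

/-! ### A representation in which every vertex acts nontrivially -/

namespace LeavittPath

variable (K : Type w) [Field K] {V : Type u} {Ed : Type v} (E : DirectedGraph V Ed)

/-- A homomorphism on the free algebra that respects the defining relations identifies congruent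
elements. -/
theorem map_eq_of_con {A : Type*} [NonUnitalRing A] [Module K A]
    (f : FreeAlg K V Ed →ₙₐ[K] A) (hf : ∀ a b, Rel K E a b → f a = f b)
    {a b : FreeAlg K V Ed} (h : con K E a b) : f a = f b := by
  change RingConGen.Rel _ a b at h
  induction h with
  | of x y h =>
    obtain ⟨l, x', y', h, rfl, rfl⟩ := h
    rw [map_smul, map_smul, hf _ _ h]
  | refl => rfl
  | symm _ ih => exact ih.symm
  | trans _ _ ih ih' => exact ih.trans ih'
  | add _ _ ih ih' => rw [map_add, map_add, ih, ih']
  | mul _ _ ih ih' => rw [map_mul, map_mul, ih, ih']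

/-- The homomorphism on the free algebra determined by the images of the generators. -/
def freeLift {A : Type*} [NonUnitalRing A] [Module K A] [IsScalarTower K A A]
    [SMulCommClass K A A] (g : Gen V Ed → A) : FreeAlg K V Ed →ₙₐ[K] A :=
  MonoidAlgebra.liftMagma K (FreeSemigroup.lift g)

theorem freeLift_gen {A : Type*} [NonUnitalRing A] [Module K A] [IsScalarTower K A A]
    [SMulCommClass K A A] (g : Gen V Ed → A) (a : Gen V Ed) :
    freeLift K g (gen K a) = g a := by
  simp [freeLift, gen, MonoidAlgebra.liftMagma]

/-- In a row-finite graph, `Ed × ℕ` can be identified with the pairs `(x, n)` where `x` is not a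
sink, compatibly with the source map. -/
theorem exists_splitting (hE : E.RowFinite) : ∃ ψ : Ed → ℕ → ℕ,
    (∀ e f m n, E.s e = E.s f → ψ e m = ψ f n → e = f ∧ m = n) ∧
    ∀ e m, ∃ f n, E.s f = E.s e ∧ ψ f n = m := by
  have key : ∀ x : V, ∃ φ : {e // E.s e = x} → ℕ → ℕ,
      (∀ e f m n, φ e m = φ f n → e = f ∧ m = n) ∧
      ∀ (_ : {e // E.s e = x}) m, ∃ f n, φ f n = m := by
    intro x
    have : Finite {e // E.s e = x} := hE x
    rcases isEmpty_or_nonempty {e // E.s e = x} with h | h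
    · exact ⟨fun _ _ => 0, fun e => h.elim e, fun e => h.elim e⟩
    · obtain ⟨φ⟩ : Nonempty ({e // E.s e = x} × ℕ ≃ ℕ) := nonempty_equiv_of_countable
      refine ⟨fun e n => φ (e, n), fun e f m n h => ?_, fun _ m => ?_⟩
      · simpa using φ.injective h
      · exact ⟨(φ.symm m).1, (φ.symm m).2, by simp⟩
  choose φ hφ hφ' using key
  refine ⟨fun e n => φ (E.s e) ⟨e, rfl⟩ n, fun e f m n h h' => ?_, fun e m => ?_⟩
  · have aux : ∀ (x : V) (hx : E.s f = x), φ (E.s f) ⟨f, rfl⟩ n = φ x ⟨f, hx⟩ n := by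
      rintro _ rfl; rfl
    simpa using hφ _ _ _ _ _ (h'.trans (aux _ h.symm))
  · obtain ⟨⟨f, hf⟩, n, h⟩ := hφ' (E.s e) ⟨e, rfl⟩ m
    refine ⟨f, n, hf, ?_⟩
    rw [← h]
    have aux : ∀ (x : V) (hx : E.s f = x), φ (E.s f) ⟨f, rfl⟩ n = φ x ⟨f, hx⟩ n := by
      rintro _ rfl; rfl
    exact aux _ hf

open Classical in
/-- The action of the generators on functions `V × ℕ → K` that a splitting `ψ` induces. -/
def genAction (ψ : Ed → ℕ → ℕ) : Gen V Ed → Module.End K (V → ℕ → K)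
  | .vertex x =>
    { toFun := fun ξ y n => if y = x then ξ y n else 0
      map_add' := fun ξ η => by ext y n; by_cases h : y = x <;> simp [h]
      map_smul' := fun k ξ => by ext y n; by_cases h : y = x <;> simp [h] }
  | .edge e =>
    -- The edge moves the values over r(e) into the block ψ e (ℕ) over s(e) and puts 0 elsewhere;
    -- the ghost edge reads that block back.
    { toFun := fun ξ y m => if h : y = E.s e ∧ ∃ n, ψ e n = m then ξ (E.r e) h.2.choose else 0
      map_add' := fun ξ η => by
        ext y m; by_cases h : y = E.s e ∧ ∃ n, ψ e n = m <;> simp [h]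
      map_smul' := fun k ξ => by
        ext y m; by_cases h : y = E.s e ∧ ∃ n, ψ e n = m <;> simp [h] }
  | .ghost e =>
    { toFun := fun ξ y n => if y = E.r e then ξ (E.s e) (ψ e n) else 0
      map_add' := fun ξ η => by ext y n; by_cases h : y = E.r e <;> simp [h]
      map_smul' := fun k ξ => by ext y n; by_cases h : y = E.r e <;> simp [h] }

section genAction

variable {E} {ψ : Ed → ℕ → ℕ}

open Classical in
theorem genAction_vertex (x : V) (ξ : V → ℕ → K) (y : V) (n : ℕ) :
    genAction K E ψ (.vertex x) ξ y n = if y = x then ξ y n else 0 := rfl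

open Classical in
theorem genAction_ghost (e : Ed) (ξ : V → ℕ → K) (y : V) (n : ℕ) :
    genAction K E ψ (.ghost e) ξ y n = if y = E.r e then ξ (E.s e) (ψ e n) else 0 := rfl

theorem genAction_edge (hψ : ∀ e f m n, E.s e = E.s f → ψ e m = ψ f n → e = f ∧ m = n)
    (e : Ed) (ξ : V → ℕ → K) (n : ℕ) :
    genAction K E ψ (.edge e) ξ (E.s e) (ψ e n) = ξ (E.r e) n := by
  have h : E.s e = E.s e ∧ ∃ m, ψ e m = ψ e n := ⟨rfl, n, rfl⟩
  have h' := (hψ e e _ _ rfl h.2.choose_spec).2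
  simp only [genAction, LinearMap.coe_mk, AddHom.coe_mk]
  rw [dif_pos h, h']

theorem genAction_edge_of_ne (e : Ed) (ξ : V → ℕ → K) (y : V) (m : ℕ)
    (h : ¬ (y = E.s e ∧ ∃ n, ψ e n = m)) :
    genAction K E ψ (.edge e) ξ y m = 0 := dif_neg h

theorem genAction_rel (hψ : ∀ e f m n, E.s e = E.s f → ψ e m = ψ f n → e = f ∧ m = n)
    (hψ' : ∀ e m, ∃ f n, E.s f = E.s e ∧ ψ f n = m) {a b : FreeAlg K V Ed} (h : Rel K E a b) :
    freeLift K (genAction K E ψ) a = freeLift K (genAction K E ψ) b := by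
  induction h with
  | vertex_self x =>
    simp only [map_mul, freeLift_gen]
    ext ξ y n
    simp only [Module.End.mul_apply, genAction_vertex]
    split_ifs <;> rfl
  | vertex_ne x y h =>
    simp only [map_mul, freeLift_gen, map_zero]
    ext ξ z n
    simp only [Module.End.mul_apply, genAction_vertex, LinearMap.zero_apply, Pi.zero_apply]
    aesop
  | source_edge e =>
    simp only [map_mul, freeLift_gen]
    ext ξ y n
    simp only [Module.End.mul_apply, genAction_vertex]
    split_ifs with h
    · rfl
    · rw [genAction_edge_of_ne]; exact fun h' => h h'.1
  | edge_range e =>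
    simp only [map_mul, freeLift_gen]
    ext ξ y n
    simp only [Module.End.mul_apply]
    by_cases h : y = E.s e ∧ ∃ m, ψ e m = n
    · obtain ⟨rfl, m, rfl⟩ := h
      simp [genAction_edge K hψ, genAction_vertex]
    · rw [genAction_edge_of_ne K _ _ _ _ h, genAction_edge_of_ne K _ _ _ _ h]
  | range_ghost e =>
    simp only [map_mul, freeLift_gen]
    ext ξ y n
    simp only [Module.End.mul_apply, genAction_vertex, genAction_ghost]
    aesop
  | ghost_source e =>
    simp only [map_mul, freeLift_gen]
    ext ξ y n
    simp only [Module.End.mul_apply, genAction_vertex, genAction_ghost]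
    aesop
  | ck1_self e =>
    simp only [map_mul, freeLift_gen]
    ext ξ y n
    simp only [Module.End.mul_apply, genAction_vertex, genAction_ghost, genAction_edge K hψ]
    aesop
  | ck1_ne e f h =>
    simp only [map_mul, freeLift_gen, map_zero]
    ext ξ y n
    simp only [Module.End.mul_apply, genAction_ghost, LinearMap.zero_apply, Pi.zero_apply]
    split_ifs with h'
    · rw [genAction_edge_of_ne]
      rintro ⟨h1, m, h2⟩
      exact h (hψ f e m n h1.symm h2).1.symm
    · rfl
  | ck2 x S hS hne =>
    simp only [map_sum, map_mul, freeLift_gen]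
    ext ξ y n
    simp only [LinearMap.sum_apply, Finset.sum_apply, Module.End.mul_apply, genAction_vertex]
    obtain ⟨e, he⟩ := hne
    split_ifs with hy
    · subst hy
      -- The blocks cover ℕ, so `n` lies in the block of some edge `f`; they are disjoint, so only
      -- `f` contributes to the sum.
      obtain ⟨f, m, hf, rfl⟩ := hψ' e n
      rw [(hS e).1 he] at hf
      rw [Finset.sum_eq_single_of_mem f ((hS f).2 hf)]
      · subst hf
        rw [genAction_edge K hψ, genAction_ghost, if_pos rfl]
      · intro g hg hgf
        rw [genAction_edge_of_ne]
        rintro ⟨h1, k, h2⟩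
        exact hgf (hψ g f k m (h1.symm.trans hf.symm) h2).1
    · refine Finset.sum_eq_zero fun g hg => ?_
      rw [genAction_edge_of_ne]
      rintro ⟨h1, -⟩
      exact hy (h1.trans ((hS g).1 hg))

end genAction

end LeavittPath

/-- The vertices of a row-finite graph are nonzero elements of the Leavitt path algebra. -/
theorem LeavittPathAlgebra.vertex_ne_zero (K : Type w) [Field K] {V : Type u} {Ed : Type v}
    {E : DirectedGraph V Ed} (hE : E.RowFinite) (x : V) : vertex K E x ≠ 0 := by
  obtain ⟨ψ, hψ, hψ'⟩ := LeavittPath.exists_splitting E hE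
  intro h
  have h0 : LeavittPath.con K E (LeavittPath.gen K (.vertex x)) 0 := Quotient.exact h
  have h1 := LeavittPath.map_eq_of_con K E _
    (fun a b => LeavittPath.genAction_rel K (E := E) hψ hψ') h0
  rw [LeavittPath.freeLift_gen, map_zero] at h1
  have h2 := congrFun (congrFun (LinearMap.congr_fun h1 fun _ _ => 1) x) 0
  simp [LeavittPath.genAction_vertex] at h2

/-! ### Paths, connectivity and cycles -/

namespace DirectedGraph

variable {V : Type u} {Ed : Type v} {E : DirectedGraph V Ed}

/-- Prolong a path by an edge at its source. -/
def Path.cons (e : Ed) (α : E.Path) (h : α.source = E.r e) : E.Path where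
  source := E.s e
  edges := e :: α.edges
  range := α.range
  isPath := ⟨rfl, h ▸ α.isPath⟩

theorem isPath_append {x z : V} {p q : List Ed} :
    E.IsPath x (p ++ q) z ↔ ∃ y, E.IsPath x p y ∧ E.IsPath y q z := by
  induction p generalizing x with
  | nil => simp [IsPath]
  | cons e p ih => simp [IsPath, ih, and_assoc]

theorem isPath_range_unique {x y z : V} {p : List Ed} (h : E.IsPath x p y) (h' : E.IsPath x p z) :
    y = z := by
  induction p generalizing x with
  | nil => exact h.symm.trans h'
  | cons e p ih => exact ih h.2 h'.2

theorem connects_iff {x y : V} : E.Connects x y ↔ ∃ p, E.IsPath x p y :=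
  ⟨fun ⟨α, hx, hy⟩ => ⟨α.edges, hx ▸ hy ▸ α.isPath⟩, fun ⟨p, hp⟩ => ⟨⟨x, p, y, hp⟩, rfl, rfl⟩⟩

theorem Connects.refl (x : V) : E.Connects x x := connects_iff.2 ⟨[], rfl⟩

theorem Connects.trans {x y z : V} (h : E.Connects x y) (h' : E.Connects y z) :
    E.Connects x z := by
  obtain ⟨p, hp⟩ := connects_iff.1 h
  obtain ⟨q, hq⟩ := connects_iff.1 h'
  exact connects_iff.2 ⟨p ++ q, isPath_append.2 ⟨y, hp, hq⟩⟩

theorem connects_edge (e : Ed) : E.Connects (E.s e) (E.r e) := connects_iff.2 ⟨[e], rfl, rfl⟩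

/-- Reachability induction along the edges of a path. -/
theorem Connects.induction {C : V → Prop} (step : ∀ e, C (E.s e) → C (E.r e)) {x y : V}
    (h : E.Connects x y) (hx : C x) : C y := by
  obtain ⟨p, hp⟩ := connects_iff.1 h
  clear h
  induction p generalizing x with
  | nil => exact hp ▸ hx
  | cons e p ih =>
    obtain ⟨rfl, hp⟩ := hp
    exact ih (step e hx) hp

theorem Connects.eq_of_sink {x y : V} (h : E.Connects x y) (hx : ∀ e, E.s e ≠ x) : y = x :=
  h.induction (C := fun z => z = x) (fun e he => (hx e he).elim) rfl

theorem exists_edge_of_isPath {x y : V} {p : List Ed} (h : E.IsPath x p y) (hp : p ≠ []) :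
    ∃ e, E.s e = x ∧ E.Connects (E.r e) y := by
  cases p with
  | nil => exact (hp rfl).elim
  | cons e p => exact ⟨e, h.1, connects_iff.2 ⟨p, h.2⟩⟩

/-- A path to `x` can be replaced by one whose edges have distinct sources, none of which
is `x`. -/
theorem exists_simple_path {a x : V} {p : List Ed} (h : E.IsPath a p x) :
    ∃ q, E.IsPath a q x ∧ (q.map E.s).Nodup ∧ x ∉ q.map E.s := by
  induction p generalizing a with
  | nil => exact ⟨[], h, by simp, by simp⟩
  | cons e p ih =>
    obtain ⟨rfl, h⟩ := h
    obtain ⟨q, hq, hnd, hx⟩ := ih h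
    by_cases hax : E.s e = x
    · exact ⟨[], hax, by simp, by simp⟩
    by_cases ha : E.s e ∈ q.map E.s
    -- If `q` returns to s(e), the loop before that return is cut off, and so is `e`.
    · obtain ⟨f, hf, hfe⟩ := List.mem_map.1 ha
      obtain ⟨l, m, rfl⟩ := List.append_of_mem hf
      obtain ⟨y, -, hy⟩ := isPath_append.1 hq
      rw [List.map_append] at hnd hx
      refine ⟨f :: m, ⟨hfe, hy.2⟩, (List.nodup_append.1 hnd).2.1, fun h' => hx ?_⟩
      exact List.mem_append_right _ h'
    · exact ⟨e :: q, ⟨rfl, hq⟩, by simpa using ⟨by simpa using ha, hnd⟩,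
        by simpa using ⟨fun h' => hax h'.symm, by simpa using hx⟩⟩

/-- The base point of a nontrivial closed path lies on a cycle. -/
theorem exists_isCycle {x : V} {p : List Ed} (h : E.IsPath x p x) (hp : p ≠ []) :
    ∃ c, E.IsCycle c ∧ x ∈ E.vertices c := by
  cases p with
  | nil => exact (hp rfl).elim
  | cons e p =>
    obtain ⟨rfl, h⟩ := h
    obtain ⟨q, hq, hnd, hx⟩ := exists_simple_path h
    refine ⟨e :: q, ⟨by simp, ⟨_, rfl, hq⟩, ?_⟩, e, by simp, Or.inl rfl⟩
    rw [List.map_cons, List.nodup_cons]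
    exact ⟨hx, hnd⟩

/-- Rotate the cycle so that it starts at `z`; the cut falls before or after the edge `e`, according
to which end of `e` is `z`. -/
theorem exists_closed_path {c : List Ed} (hc : E.IsCycle c) {z : V} (hz : z ∈ E.vertices c) :
    ∃ p, p ≠ [] ∧ E.IsPath z p z := by
  obtain ⟨-, ⟨x, hx⟩, -⟩ := hc
  obtain ⟨e, he, hz⟩ := hz
  obtain ⟨l, m, rfl⟩ := List.append_of_mem he
  obtain ⟨y, hl, rfl, hm⟩ := isPath_append.1 hx
  rcases hz with rfl | rfl
  · exact ⟨e :: m ++ l, by simp, isPath_append.2 ⟨x, ⟨rfl, hm⟩, hl⟩⟩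
  · exact ⟨m ++ (l ++ [e]), by simp,
      isPath_append.2 ⟨x, hm, isPath_append.2 ⟨E.s e, hl, rfl, rfl⟩⟩⟩

/-- Closed paths can be repeated: there are arbitrarily long ones. -/
theorem exists_long_closed_path {z : V} {p : List Ed} (hp : p ≠ []) (h : E.IsPath z p z) (n : ℕ) :
    ∃ q, E.IsPath z q z ∧ n ≤ q.length := by
  induction n with
  | zero => exact ⟨p, h, Nat.zero_le _⟩
  | succ n ih =>
    obtain ⟨q, hq, hn⟩ := ih
    refine ⟨p ++ q, isPath_append.2 ⟨z, h, hq⟩, ?_⟩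
    have := List.length_pos_iff.2 hp
    rw [List.length_append]
    omega

/-! ### Classes of vertices of P and their saturated closures -/

variable (E) in
/-- The vertices that see no bifurcation or lie below a cycle. -/
def Tame (x : V) : Prop :=
  (∀ z ∈ E.tree x, ¬ E.IsBifurcation z) ∨ ∃ c, E.IsCycle c ∧ ∃ z ∈ E.vertices c, E.Connects z x

theorem tame_of_mem_P {x : V} (hx : x ∈ E.P) : E.Tame x := by
  rcases hx with (hx | ⟨c, hc, -, hx⟩) | ⟨c, hc, hx⟩
  · exact Or.inl fun z hz => (hx z hz).1
  · exact Or.inr ⟨c, hc, x, hx, .refl x⟩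
  · exact Or.inr ⟨c, hc.1, x, hx, .refl x⟩

theorem Tame.of_rel₁ {x y : V} (h : E.Tame x) (hxy : E.Rel₁ x y) : E.Tame y := by
  rcases hxy with rfl | ⟨-, hz⟩ | ⟨c, hc, z, hz, -, hy⟩
  · exact h
  · exact Or.inl fun z hz' => hz z (Or.inr hz')
  · exact Or.inr ⟨c, hc, z, hz, hy⟩

/-- The purpose of `Tame`: either alternative is inherited by every vertex below `x`, so connection
alone yields ∼¹. This makes the classes in X hereditary. -/
theorem Tame.rel₁ {x y : V} (h : E.Tame x) (hxy : E.Connects x y) : E.Rel₁ x y := by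
  rcases h with h | ⟨c, hc, z, hz, hx⟩
  · exact Or.inr (Or.inl ⟨Or.inl hxy, fun z hz =>
      h z (hz.elim id fun hz => Connects.trans hxy hz)⟩)
  · exact Or.inr (Or.inr ⟨c, hc, z, hz, hx, hx.trans hxy⟩)

theorem tame_of_mem_class {q : E.Class} (hq : q ∈ E.X) {x : V} (hx : x ∈ q.carrier) :
    E.Tame x := by
  obtain ⟨p, hp, rfl⟩ := hq
  have h : Relation.TransGen E.Rel₁ p x := Quotient.exact (Eq.symm hx)
  have hp := tame_of_mem_P hp
  induction h with
  | single h => exact hp.of_rel₁ h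
  | tail _ h ih => exact Tame.of_rel₁ (ih (Quotient.sound ‹_›).symm) h

theorem Rel₁.mem_carrier {x y : V} (h : E.Rel₁ x y) {q : E.Class} (hx : x ∈ q.carrier) :
    y ∈ q.carrier :=
  (Quotient.sound (s := E.equiv) (Relation.TransGen.single h)).symm.trans hx

theorem class_hereditary {q : E.Class} (hq : q ∈ E.X) {x y : V} (hx : x ∈ q.carrier)
    (h : E.Connects x y) : y ∈ q.carrier :=
  ((tame_of_mem_class hq hx).rel₁ h).mem_carrier hx

theorem satStep_hereditary {H : Set V} (hH : ∀ e, E.s e ∈ H → E.r e ∈ H) (n : ℕ) (e : Ed)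
    (he : E.s e ∈ E.satStep H n) : E.r e ∈ E.satStep H n := by
  induction n with
  | zero => exact hH e he
  | succ n ih => exact he.elim (fun he => Or.inl (ih he)) fun he => Or.inl (he.2.2 e rfl)

/-- Induction principle for the saturated closure. -/
theorem satClosure_induction {H : Set V} {C : V → Prop} (base : ∀ x ∈ H, C x)
    (step : ∀ x, (∃ e, E.s e = x) → (∀ e, E.s e = x → C (E.r e)) → C x) {x : V}
    (hx : x ∈ E.satClosure H) : C x := by
  obtain ⟨n, hn⟩ := Set.mem_iUnion.1 hx
  clear hx
  induction n generalizing x with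
  | zero => exact base x hn
  | succ n ih => exact hn.elim ih fun hx => step x hx.1 fun e he => ih (hx.2.2 e he)

theorem subset_satClosure (H : Set V) : H ⊆ E.satClosure H :=
  fun _ hx => Set.mem_iUnion.2 ⟨0, hx⟩

theorem carrier_subset_closure (q : E.Class) : q.carrier ⊆ q.closure := subset_satClosure _

theorem closure_hereditary {q : E.Class} (hq : q ∈ E.X) (e : Ed)
    (he : E.s e ∈ q.closure) : E.r e ∈ q.closure := by
  obtain ⟨n, hn⟩ := Set.mem_iUnion.1 he
  exact Set.mem_iUnion.2 ⟨n, satStep_hereditary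
    (fun e he => class_hereditary hq he (connects_edge e)) n e hn⟩

theorem exists_connects_of_mem_closure {q : E.Class} {x : V} (hx : x ∈ q.closure) :
    ∃ y ∈ q.carrier, E.Connects x y := by
  refine satClosure_induction (C := fun x => ∃ y ∈ q.carrier, E.Connects x y)
    (fun x hx => ⟨x, hx, .refl x⟩) ?_ hx
  rintro _ ⟨e, rfl⟩ h
  obtain ⟨y, hy, h⟩ := h e rfl
  exact ⟨y, hy, (connects_edge e).trans h⟩

/-- Vertices of different classes in `X` are not connected through the closures of the classes. -/
theorem not_connects_closure {q q' : E.Class} (hq' : q' ∈ E.X) (hne : q ≠ q')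
    {x y : V} (hx : x ∈ q'.carrier) (hxy : E.Connects x y) : y ∉ q.closure := by
  intro hy
  obtain ⟨z, hz, hyz⟩ := exists_connects_of_mem_closure hy
  exact hne (Eq.trans hz.symm (class_hereditary hq' hx (hxy.trans hyz)))

/-- A vertex with finite tree connects to a vertex of `P`. -/
theorem exists_mem_P {x : V} (hx : (E.tree x).Finite) : ∃ y ∈ E.P, E.Connects x y := by
  -- For `y` with smallest tree, every vertex below `y` has the same tree and so connects back to
  -- `y`. Thus `y` is a sink or lies on a cycle that is extreme or has no exit.
  obtain ⟨y, hy, hmin⟩ := Set.exists_min_image (E.tree x) (fun y => (E.tree y).ncard) hx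
    ⟨x, .refl x⟩
  have sub : ∀ {a b}, E.Connects a b → E.tree b ⊆ E.tree a := fun h _ hz => Connects.trans h hz
  have hyfin : (E.tree y).Finite := hx.subset (sub hy)
  have back : ∀ z ∈ E.tree y, E.Connects z y := fun z hz => by
    have := Set.eq_of_subset_of_ncard_le (sub hz) (hmin z (Connects.trans hy hz)) hyfin
    have h' : y ∈ E.tree z := this ▸ Connects.refl y
    exact h'
  refine ⟨y, ?_, hy⟩
  by_cases hs : ∃ e, E.s e = y
  · obtain ⟨e, rfl⟩ := hs
    obtain ⟨p, hp⟩ := connects_iff.1 (back _ (connects_edge e))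
    obtain ⟨c, hc, hyc⟩ := exists_isCycle (p := e :: p) ⟨rfl, hp⟩ (by simp)
    by_cases hex : E.HasExit c
    · refine Or.inr ⟨c, ⟨hc, hex, fun α hα => ⟨_, hyc, back _ ?_⟩⟩, hyc⟩
      have : E.Connects (E.s e) α.source := by
        obtain ⟨-, ⟨z, hz⟩, -⟩ := hc
        have aux : ∀ f ∈ c, E.Connects z (E.s f) ∧ E.Connects (E.r f) z := fun f hf => by
          obtain ⟨l, m, rfl⟩ := List.append_of_mem hf
          obtain ⟨_, hl, rfl, hm⟩ := isPath_append.1 hz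
          exact ⟨connects_iff.2 ⟨l, hl⟩, connects_iff.2 ⟨m, hm⟩⟩
        have aux' : ∀ a ∈ E.vertices c, E.Connects z a ∧ E.Connects a z := by
          rintro a ⟨f, hf, rfl | rfl⟩
          · exact ⟨(aux f hf).1, (connects_edge f).trans (aux f hf).2⟩
          · exact ⟨(aux f hf).1.trans (connects_edge f), (aux f hf).2⟩
        exact (aux' _ hyc).2.trans (aux' _ hα).1
      exact this.trans ⟨α, rfl, rfl⟩
    · exact Or.inl (Or.inr ⟨c, hc, hex, hyc⟩)
  · push Not at hs
    refine Or.inl (Or.inl fun z hz => ?_)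
    have hzy : z = y := Connects.eq_of_sink hz hs
    subst hzy
    refine ⟨fun ⟨e, _, _, he, _⟩ => hs e he, fun ⟨c, hc, hzc⟩ => ?_⟩
    obtain ⟨p, hp, hzp⟩ := exists_closed_path hc hzc
    obtain ⟨e, he, -⟩ := exists_edge_of_isPath hzp hp
    exact hs e he

/-- A path that ends in `H` without meeting it before has edges with distinct sources if vertices
on cycles that connect to `H` belong to `H`. -/
theorem nodup_of_mem_F {H : Set V}
    (hH : ∀ z p, p ≠ [] → E.IsPath z p z → ∀ y ∈ H, E.Connects z y → z ∈ H)
    {p : List Ed} {x y : V} (hp : E.IsPath x p y) (hx : x ∉ H)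
    (hr : ∀ e ∈ p.dropLast, E.r e ∉ H) (hy : y ∈ H) : (p.map E.s).Nodup := by
  induction p generalizing x with
  | nil => simp
  | cons e p ih =>
    obtain ⟨rfl, hp⟩ := hp
    -- A second visit to s(e) would close a path through s(e), which connects to `H`; then s(e)
    -- would lie in `H`.
    have h1 : E.s e ∉ p.map E.s := fun h => by
      obtain ⟨f, hf, hfe⟩ := List.mem_map.1 h
      obtain ⟨l, m, rfl⟩ := List.append_of_mem hf
      obtain ⟨z, hl, rfl, hm⟩ := isPath_append.1 hp
      exact hx (hH _ (e :: l) (by simp) ⟨rfl, hfe ▸ hl⟩ y hy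
        ((connects_edge e).trans (connects_iff.2 ⟨_, hp⟩)))
    rw [List.map_cons, List.nodup_cons]
    refine ⟨h1, ?_⟩
    rcases eq_or_ne p [] with rfl | hne
    · simp
    · rw [List.dropLast_cons_of_ne_nil hne] at hr
      exact ih hp (hr e (by simp)) fun f hf => hr f (by simp [hf])

end DirectedGraph

/-! ### Arithmetic of paths and of the degree zero component -/

namespace LeavittPathAlgebra

open DirectedGraph

variable {K : Type w} [Field K] {V : Type u} {Ed : Type v} {E : DirectedGraph V Ed}

theorem mk_eq_of_rel {a b : LeavittPath.FreeAlg K V Ed} (h : LeavittPath.Rel K E a b) :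
    mk K E a = mk K E b :=
  Quotient.sound (s := (LeavittPath.con K E).toSetoid)
    (RingConGen.Rel.of _ _ ⟨1, a, b, h, (one_smul _ _).symm, (one_smul _ _).symm⟩)

theorem mk_mul (a b : LeavittPath.FreeAlg K V Ed) : mk K E (a * b) = mk K E a * mk K E b := rfl

theorem mk_add (a b : LeavittPath.FreeAlg K V Ed) : mk K E (a + b) = mk K E a + mk K E b := rfl

theorem mk_zero : mk K E 0 = 0 := rfl

theorem mk_smul (k : K) (a : LeavittPath.FreeAlg K V Ed) : mk K E (k • a) = k • mk K E a := rfl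

theorem mk_sum {ι : Type*} (S : Finset ι) (a : ι → LeavittPath.FreeAlg K V Ed) :
    mk K E (∑ i ∈ S, a i) = ∑ i ∈ S, mk K E (a i) :=
  map_sum (⟨⟨mk K E, rfl⟩, fun _ _ => rfl⟩ : LeavittPath.FreeAlg K V Ed →+ LeavittPathAlgebra K E)
    a S

theorem vertex_mul_self (x : V) : vertex K E x * vertex K E x = vertex K E x :=
  mk_eq_of_rel (.vertex_self x)

theorem vertex_mul_of_ne {x y : V} (h : x ≠ y) : vertex K E x * vertex K E y = 0 :=
  mk_eq_of_rel (.vertex_ne x y h)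

theorem source_mul_edge (e : Ed) : vertex K E (E.s e) * edge K E e = edge K E e :=
  mk_eq_of_rel (.source_edge e)

theorem edge_mul_range (e : Ed) : edge K E e * vertex K E (E.r e) = edge K E e :=
  mk_eq_of_rel (.edge_range e)

theorem range_mul_ghostEdge (e : Ed) :
    vertex K E (E.r e) * ghostEdge K E e = ghostEdge K E e :=
  mk_eq_of_rel (.range_ghost e)

theorem ghostEdge_mul_source (e : Ed) :
    ghostEdge K E e * vertex K E (E.s e) = ghostEdge K E e :=
  mk_eq_of_rel (.ghost_source e)

theorem ghostEdge_mul_edge (e : Ed) : ghostEdge K E e * edge K E e = vertex K E (E.r e) :=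
  mk_eq_of_rel (.ck1_self e)

theorem ghostEdge_mul_edge_of_ne {e f : Ed} (h : e ≠ f) : ghostEdge K E e * edge K E f = 0 :=
  mk_eq_of_rel (.ck1_ne e f h)

theorem sum_edge_mul_ghostEdge {x : V} {S : Finset Ed} (hS : ∀ e, e ∈ S ↔ E.s e = x)
    (hne : S.Nonempty) : ∑ e ∈ S, edge K E e * ghostEdge K E e = vertex K E x := by
  rw [vertex, ← mk_eq_of_rel (.ck2 x S hS hne), mk_sum]
  rfl

/-- An element commuting with the generators is central. -/
theorem mem_center_of_commute {a : LeavittPathAlgebra K E}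
    (hv : ∀ x, a * vertex K E x = vertex K E x * a) (he : ∀ e, a * edge K E e = edge K E e * a)
    (hg : ∀ e, a * ghostEdge K E e = ghostEdge K E e * a) :
    a ∈ NonUnitalSubalgebra.center K (LeavittPathAlgebra K E) := by
  rw [NonUnitalSubalgebra.mem_center_iff]
  intro b
  obtain ⟨b, rfl⟩ := mk_surjective K E b
  have hgen : ∀ g : LeavittPath.Gen V Ed, a * mk K E (LeavittPath.gen K g) =
      mk K E (LeavittPath.gen K g) * a := by
    rintro (x | e | e)
    exacts [hv x, he e, hg e]
  have hmon : ∀ m : FreeSemigroup (LeavittPath.Gen V Ed),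
      a * mk K E (MonoidAlgebra.single m 1) = mk K E (MonoidAlgebra.single m 1) * a := by
    intro m
    induction m using FreeSemigroup.recOnMul with
    | ih1 g => exact hgen g
    | ih2 g m ih1 ih2 =>
      have : (MonoidAlgebra.single (FreeSemigroup.of g * m) 1 : LeavittPath.FreeAlg K V Ed) =
          MonoidAlgebra.single (FreeSemigroup.of g) 1 * MonoidAlgebra.single m 1 := by
        rw [MonoidAlgebra.single_mul_single, one_mul]
      rw [this, mk_mul, ← mul_assoc, ih1, mul_assoc, ih2, mul_assoc]
  induction b using MonoidAlgebra.induction_linear with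
  | zero => rw [mk_zero, mul_zero, zero_mul]
  | add f g hf hg => rw [mk_add, mul_add, add_mul, hf, hg]
  | single m k =>
    have : (MonoidAlgebra.single m k : LeavittPath.FreeAlg K V Ed) =
        k • MonoidAlgebra.single m 1 := by simp
    rw [this, mk_smul, mul_smul_comm, smul_mul_assoc, hmon]

variable (K E) in
/-- The product of the edges of a list, followed by a vertex. -/
def listPath (p : List Ed) (y : V) : LeavittPathAlgebra K E :=
  p.foldr (fun e a => edge K E e * a) (vertex K E y)

variable (K E) in
/-- The product of the ghost edges of a list in reverse order, preceded by a vertex. -/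
def listGhost (p : List Ed) (y : V) : LeavittPathAlgebra K E :=
  p.foldr (fun e a => a * ghostEdge K E e) (vertex K E y)

theorem listPath_nil (y : V) : listPath K E [] y = vertex K E y := rfl

theorem listGhost_nil (y : V) : listGhost K E [] y = vertex K E y := rfl

theorem listPath_cons (e : Ed) (p : List Ed) (y : V) :
    listPath K E (e :: p) y = edge K E e * listPath K E p y := rfl

theorem listGhost_cons (e : Ed) (p : List Ed) (y : V) :
    listGhost K E (e :: p) y = listGhost K E p y * ghostEdge K E e := rfl

theorem path_eq (α : E.Path) : path K α = listPath K E α.edges α.range := rfl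

theorem ghostPath_eq (α : E.Path) : ghostPath K α = listGhost K E α.edges α.range := rfl

theorem source_mul_listPath {x y : V} {p : List Ed} (h : E.IsPath x p y) :
    vertex K E x * listPath K E p y = listPath K E p y := by
  cases p with
  | nil => obtain rfl : x = y := h; exact vertex_mul_self x
  | cons e p => obtain ⟨rfl, h⟩ := h; rw [listPath_cons, ← mul_assoc, source_mul_edge]

theorem listGhost_mul_source {x y : V} {p : List Ed} (h : E.IsPath x p y) :
    listGhost K E p y * vertex K E x = listGhost K E p y := by
  cases p with
  | nil => obtain rfl : x = y := h; exact vertex_mul_self x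
  | cons e p => obtain ⟨rfl, h⟩ := h; rw [listGhost_cons, mul_assoc, ghostEdge_mul_source]

theorem listGhost_mul_listPath {x y : V} {p : List Ed} (h : E.IsPath x p y) :
    listGhost K E p y * listPath K E p y = vertex K E y := by
  induction p generalizing x with
  | nil => exact vertex_mul_self y
  | cons e p ih =>
    rw [listGhost_cons, listPath_cons, mul_assoc, ← mul_assoc (ghostEdge K E e),
      ghostEdge_mul_edge, source_mul_listPath h.2, ih h.2]

theorem vertex_mul_listPath_of_ne {x y z : V} {p : List Ed} (h : E.IsPath x p y) (hz : z ≠ x) :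
    vertex K E z * listPath K E p y = 0 := by
  rw [← source_mul_listPath h, ← mul_assoc, vertex_mul_of_ne hz, zero_mul]

theorem listGhost_mul_vertex_of_ne {x y z : V} {p : List Ed} (h : E.IsPath x p y) (hz : z ≠ x) :
    listGhost K E p y * vertex K E z = 0 := by
  rw [← listGhost_mul_source h, mul_assoc, vertex_mul_of_ne hz.symm, mul_zero]

/-- Compressing `γδ*` with `|γ| = |δ|` by a long or maximal path gives a scalar multiple of a
vertex. -/
theorem exists_compress_eq_smul {a b : V} {p g d : List Ed} {c c' : V} (hp : E.IsPath a p b)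
    (hlen : g.length = d.length) (h : g.length ≤ p.length ∨ ∀ e, E.s e ≠ b)
    {a₁ a₂ : V} (hg : E.IsPath a₁ g c) (hd : E.IsPath a₂ d c') :
    ∃ k : K, listGhost K E p b * (listPath K E g c * listGhost K E d c') * listPath K E p b =
      k • vertex K E b := by
  induction p generalizing g d a a₁ a₂ with
  | nil =>
    obtain rfl : a = b := hp
    cases g with
    | nil =>
      obtain rfl := List.length_eq_zero_iff.1 hlen.symm
      simp only [listPath_nil, listGhost_nil]
      by_cases h1 : a = c
      · subst h1
        by_cases h2 : a = c'
        · subst h2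
          exact ⟨1, by simp only [vertex_mul_self, one_smul]⟩
        · exact ⟨0, by simp [vertex_mul_of_ne h2]⟩
      · exact ⟨0, by rw [← mul_assoc, vertex_mul_of_ne h1]; simp⟩
    | cons e g =>
      -- The length alternative is impossible for empty `p`, so `a` is a sink and no nonempty `g`
      -- starts there.
      have hs : E.s e ≠ a := by
        rcases h with h | h
        · simp at h
        · exact h e
      refine ⟨0, ?_⟩
      rw [← mul_assoc, listGhost_nil, vertex_mul_listPath_of_ne hg (by rw [← hg.1]; exact hs.symm)]
      simp
  | cons f p ih =>
    obtain ⟨rfl, hp⟩ := hp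
    cases g with
    | nil =>
      obtain rfl := List.length_eq_zero_iff.1 hlen.symm
      simp only [listPath_nil, listGhost_nil]
      have hfp : E.IsPath (E.s f) (f :: p) b := ⟨rfl, hp⟩
      by_cases h1 : E.s f = c
      · by_cases h2 : E.s f = c'
        · refine ⟨1, ?_⟩
          rw [← h1, ← h2, vertex_mul_self, listGhost_mul_source hfp, listGhost_mul_listPath hfp,
            one_smul]
        · refine ⟨0, ?_⟩
          rw [mul_assoc, mul_assoc, vertex_mul_listPath_of_ne hfp (Ne.symm h2)]
          simp
      · refine ⟨0, ?_⟩
        rw [← mul_assoc, listGhost_mul_vertex_of_ne hfp (Ne.symm h1)]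
        simp
    | cons e g =>
      cases d with
      | nil => simp at hlen
      | cons e' d =>
        have expand : listGhost K E (f :: p) b *
            (listPath K E (e :: g) c * listGhost K E (e' :: d) c') * listPath K E (f :: p) b =
            listGhost K E p b * (ghostEdge K E f * edge K E e) *
            (listPath K E g c * listGhost K E d c') *
            ((ghostEdge K E e' * edge K E f) * listPath K E p b) := by
          simp only [listGhost_cons, listPath_cons, mul_assoc]
        rw [expand]
        -- By (CK1) the inner factors f*e and e'*f vanish or cancel, leaving shorter paths.
        by_cases h1 : f = e
        · by_cases h2 : e' = f
          · subst h1 h2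
            obtain ⟨k, hk⟩ := ih hp (by simpa using hlen) (by simpa using h) hg.2 hd.2
            refine ⟨k, ?_⟩
            rw [ghostEdge_mul_edge, listGhost_mul_source hp, source_mul_listPath hp, hk]
          · exact ⟨0, by simp [ghostEdge_mul_edge_of_ne h2]⟩
        · exact ⟨0, by simp [ghostEdge_mul_edge_of_ne h1]⟩

theorem component_induction {n : ℤ} {C : LeavittPathAlgebra K E → Prop} (zero : C 0)
    (add : ∀ x y, C x → C y → C (x + y)) (smul : ∀ (k : K) x, C x → C (k • x))
    (monomial : ∀ α β : E.Path, (α.length : ℤ) - β.length = n → C (path K α * ghostPath K β))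
    {x : LeavittPathAlgebra K E} (hx : x ∈ component K E n) : C x := by
  refine Submodule.span_induction (p := fun x _ => C x) ?_ zero (fun x y _ _ => add x y)
    (fun k x _ => smul k x) hx
  rintro _ ⟨α, β, h, rfl⟩
  exact monomial α β h

/-- `N` bounds the lengths of the α in a finite expression of `x` by terms αβ*; in degree 0 the β
have the same lengths. -/
theorem exists_compress_of_mem_component {x : LeavittPathAlgebra K E}
    (hx : x ∈ component K E 0) : ∃ N : ℕ, ∀ a p b, E.IsPath a p b →
      (N ≤ p.length ∨ ∀ e, E.s e ≠ b) →
      ∃ k : K, listGhost K E p b * x * listPath K E p b = k • vertex K E b := by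
  refine component_induction (C := fun x => ∃ N : ℕ, ∀ a p b, E.IsPath a p b →
      (N ≤ p.length ∨ ∀ e, E.s e ≠ b) →
      ∃ k : K, listGhost K E p b * x * listPath K E p b = k • vertex K E b) ?_ ?_ ?_ ?_ hx
  · exact ⟨0, fun _ _ _ _ _ => ⟨0, by simp⟩⟩
  · rintro x y ⟨M, hM⟩ ⟨N, hN⟩
    refine ⟨max M N, fun a p b hp h => ?_⟩
    obtain ⟨k, hk⟩ := hM a p b hp (h.imp_left fun h => (le_max_left _ _).trans h)
    obtain ⟨l, hl⟩ := hN a p b hp (h.imp_left fun h => (le_max_right _ _).trans h)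
    exact ⟨k + l, by rw [mul_add, add_mul, hk, hl, add_smul]⟩
  · rintro l x ⟨N, hN⟩
    refine ⟨N, fun a p b hp h => ?_⟩
    obtain ⟨k, hk⟩ := hN a p b hp h
    exact ⟨l * k, by rw [mul_smul_comm, smul_mul_assoc, hk, smul_smul]⟩
  · intro α β h
    refine ⟨α.length, fun a p b hp h' => ?_⟩
    exact exists_compress_eq_smul hp (by simp only [Path.length] at h; omega) h' α.isPath β.isPath

/-- `W` collects the sources of the β in an expression of `x` by terms αβ*. All later finiteness
arguments rest on this set. -/
theorem exists_local_unit {n : ℤ} {x : LeavittPathAlgebra K E} (hx : x ∈ component K E n) :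
    ∃ W : Finset V, x = ∑ v ∈ W, x * vertex K E v := by
  classical
  have mono : ∀ {x : LeavittPathAlgebra K E} {W W' : Finset V},
      x = ∑ v ∈ W, x * vertex K E v → W ⊆ W' → x = ∑ v ∈ W', x * vertex K E v := by
    intro x W W' h hW
    rw [← Finset.sum_subset hW]
    · exact h
    · intro v _ hv
      rw [h, Finset.sum_mul]
      refine Finset.sum_eq_zero fun u hu => ?_
      rw [mul_assoc, vertex_mul_of_ne (ne_of_mem_of_not_mem hu hv), mul_zero]
  refine component_induction (C := fun x => ∃ W : Finset V, x = ∑ v ∈ W, x * vertex K E v)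
    ?_ ?_ ?_ ?_ hx
  · exact ⟨∅, by simp⟩
  · rintro x y ⟨W, hW⟩ ⟨W', hW'⟩
    refine ⟨W ∪ W', ?_⟩
    simp only [add_mul, Finset.sum_add_distrib]
    rw [← mono hW Finset.subset_union_left, ← mono hW' Finset.subset_union_right]
  · rintro k x ⟨W, hW⟩
    refine ⟨W, ?_⟩
    simp only [smul_mul_assoc, ← Finset.smul_sum]
    rw [← hW]
  · intro α β _
    refine ⟨{β.source}, ?_⟩
    rw [Finset.sum_singleton, mul_assoc, ghostPath_eq, listGhost_mul_source β.isPath]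

theorem mul_vertex_eq_zero_of_notMem {x : LeavittPathAlgebra K E} {W : Finset V}
    (h : x = ∑ v ∈ W, x * vertex K E v) {v : V} (hv : v ∉ W) : x * vertex K E v = 0 := by
  rw [h, Finset.sum_mul]
  refine Finset.sum_eq_zero fun u hu => ?_
  rw [mul_assoc, vertex_mul_of_ne (ne_of_mem_of_not_mem hu hv), mul_zero]

end LeavittPathAlgebra

namespace LeavittPathAlgebra

open DirectedGraph

variable {K : Type w} [Field K] {V : Type u} {Ed : Type v} {E : DirectedGraph V Ed}

theorem smul_vertex_injective (hE : E.RowFinite) {k l : K} {x : V}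
    (h : k • vertex K E x = l • vertex K E x) : k = l :=
  smul_left_injective K (vertex_ne_zero K hE x) h

/-! ### Central elements of degree zero act by scalars -/

section Scalar

variable {x : LeavittPathAlgebra K E} (hx : ∀ b, b * x = x * b)
include hx

theorem mul_range_eq (e : Ed) :
    x * vertex K E (E.r e) = ghostEdge K E e * (x * vertex K E (E.s e)) * edge K E e := by
  rw [mul_assoc, mul_assoc, source_mul_edge, ← mul_assoc, hx, mul_assoc, ghostEdge_mul_edge]

theorem scalar_of_connects {k : K} {a b : V} (h : x * vertex K E a = k • vertex K E a)
    (hab : E.Connects a b) : x * vertex K E b = k • vertex K E b := by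
  refine hab.induction (C := fun v => x * vertex K E v = k • vertex K E v) (fun e he => ?_) h
  rw [mul_range_eq hx, he, mul_smul_comm, ghostEdge_mul_source, smul_mul_assoc,
    ghostEdge_mul_edge]

theorem mul_vertex_eq_zero_of_connects {a b : V} (h : x * vertex K E a = 0)
    (hab : E.Connects a b) : x * vertex K E b = 0 := by
  simpa using scalar_of_connects hx (k := 0) (by simpa using h) hab

/-- By (CK2) and centrality, xa is the sum of the e(x r(e))e* over the edges e leaving `a`. -/
theorem scalar_of_ranges (hE : E.RowFinite) {k : K} {a : V} (ha : ∃ e, E.s e = a)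
    (h : ∀ e, E.s e = a → x * vertex K E (E.r e) = k • vertex K E (E.r e)) :
    x * vertex K E a = k • vertex K E a := by
  have hS : ∀ e, e ∈ (hE a).toFinset ↔ E.s e = a := fun e => by simp
  have hne : (hE a).toFinset.Nonempty := ha.imp fun e he => (hS e).2 he
  rw [← sum_edge_mul_ghostEdge hS hne, Finset.mul_sum, Finset.smul_sum]
  refine Finset.sum_congr rfl fun e he => ?_
  rw [← mul_assoc, ← hx, ← edge_mul_range, mul_assoc (edge K E e), hx, h e ((hS e).1 he),
    mul_smul_comm, smul_mul_assoc]

theorem listGhost_conj {a b : V} {p : List Ed} (hp : E.IsPath a p b) :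
    listGhost K E p b * x * listPath K E p b = x * vertex K E b := by
  rw [hx, mul_assoc, listGhost_mul_listPath hp]

theorem exists_scalar_of_long (hx0 : x ∈ component K E 0) : ∃ N : ℕ, ∀ a p b, E.IsPath a p b →
    (N ≤ p.length ∨ ∀ e, E.s e ≠ b) → ∃ k : K, x * vertex K E b = k • vertex K E b := by
  obtain ⟨N, hN⟩ := exists_compress_of_mem_component hx0
  refine ⟨N, fun a p b hp h => ?_⟩
  rw [← listGhost_conj hx hp]
  exact hN a p b hp h

/-- Descent along paths: a scalar action at the ends of all long or maximal paths starting at `a`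
propagates to `a`. -/
theorem scalar_of_long (hE : E.RowFinite) {k : K} {a : V} {N : ℕ}
    (h : ∀ p b, E.IsPath a p b → (N ≤ p.length ∨ ∀ e, E.s e ≠ b) →
      x * vertex K E b = k • vertex K E b) : x * vertex K E a = k • vertex K E a := by
  -- Here `m` bounds the number of edges still missing to length `N`; the empty path with m = N
  -- gives the claim.
  have key : ∀ m p b, E.IsPath a p b → N ≤ p.length + m →
      x * vertex K E b = k • vertex K E b := by
    intro m
    induction m with
    | zero => exact fun p b hp hN => h p b hp (Or.inl hN)
    | succ m ih =>
      intro p b hp hN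
      by_cases hb : ∃ e, E.s e = b
      · refine scalar_of_ranges hx hE hb fun e he => ih (p ++ [e]) _ ?_ ?_
        · exact isPath_append.2 ⟨b, hp, he, rfl⟩
        · simp only [List.length_append, List.length_singleton]; omega
      · push Not at hb
        exact h p b hp (Or.inr hb)
  exact key N [] a rfl (by simp)

theorem eq_zero_of_long (hE : E.RowFinite) (hx0 : x ∈ component K E 0) {N : ℕ}
    (h : ∀ a p b, E.IsPath a p b → (N ≤ p.length ∨ ∀ e, E.s e ≠ b) →
      x * vertex K E b = 0) : x = 0 := by
  obtain ⟨W, hW⟩ := exists_local_unit hx0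
  rw [hW]
  refine Finset.sum_eq_zero fun a _ => ?_
  simpa using scalar_of_long hx hE (k := 0) (a := a) (N := N)
    fun p b hp hN => by simpa using h a p b hp hN

/-- Each vertex below `a` emits at most one edge, so the common scalar needed to go backwards exists
automatically. -/
theorem exists_scalar_of_tree (hE : E.RowFinite) (hx0 : x ∈ component K E 0) {a : V}
    (ha : ∀ z ∈ E.tree a, ¬ E.IsBifurcation z) : ∃ k : K, x * vertex K E a = k • vertex K E a := by
  obtain ⟨N, hN⟩ := exists_scalar_of_long hx hx0
  have key : ∀ m p b, E.IsPath a p b → N ≤ p.length + m →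
      ∃ k : K, x * vertex K E b = k • vertex K E b := by
    intro m
    induction m with
    | zero => exact fun p b hp h => hN a p b hp (Or.inl h)
    | succ m ih =>
      intro p b hp h
      by_cases hb : ∃ e, E.s e = b
      · obtain ⟨e, he⟩ := hb
        obtain ⟨k, hk⟩ := ih (p ++ [e]) _ (isPath_append.2 ⟨b, hp, he, rfl⟩)
          (by simp only [List.length_append, List.length_singleton]; omega)
        refine ⟨k, scalar_of_ranges hx hE ⟨e, he⟩ fun f hf => ?_⟩
        have : f = e := by
          by_contra hne
          exact ha b (connects_iff.2 ⟨p, hp⟩) ⟨f, e, hne, hf, he⟩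
        rw [this, hk]
      · push Not at hb
        exact hN a p b hp (Or.inr hb)
  exact key N [] a rfl (by simp)

/-- Going round often enough gives a path of length at least `N` that ends at `z`. -/
theorem exists_scalar_of_cycle (hx0 : x ∈ component K E 0) {c : List Ed} (hc : E.IsCycle c) {z : V}
    (hz : z ∈ E.vertices c) : ∃ k : K, x * vertex K E z = k • vertex K E z := by
  obtain ⟨N, hN⟩ := exists_scalar_of_long hx hx0
  obtain ⟨p, hp, h⟩ := exists_closed_path hc hz
  obtain ⟨q, hq, hlen⟩ := exists_long_closed_path hp h N
  exact hN z q z hq (Or.inl hlen)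

theorem exists_scalar_of_tame (hE : E.RowFinite) (hx0 : x ∈ component K E 0) {a : V}
    (ha : E.Tame a) : ∃ k : K, x * vertex K E a = k • vertex K E a := by
  rcases ha with ha | ⟨c, hc, z, hz, hza⟩
  · exact exists_scalar_of_tree hx hE hx0 ha
  · exact (exists_scalar_of_cycle hx hx0 hc hz).imp fun k hk => scalar_of_connects hx hk hza

/-- Where `a` does not connect to `b`, a scalar is found at a vertex above both (`b` itself or one
on the cycle), carried down, and identified with `k` because the vertex `a` is nonzero. -/
theorem scalar_of_rel₁ (hE : E.RowFinite) (hx0 : x ∈ component K E 0) {a b : V} {k : K}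
    (ha : x * vertex K E a = k • vertex K E a) (hab : E.Rel₁ a b) :
    x * vertex K E b = k • vertex K E b := by
  rcases hab with rfl | ⟨h | h, hz⟩ | ⟨c, hc, z, hz, hza, hzb⟩
  · exact ha
  · exact scalar_of_connects hx ha h
  · obtain ⟨l, hl⟩ := exists_scalar_of_tree hx hE hx0 fun z hz' => hz z (Or.inr hz')
    have := smul_vertex_injective hE (ha.symm.trans (scalar_of_connects hx hl h))
    rw [this, hl]
  · obtain ⟨l, hl⟩ := exists_scalar_of_cycle hx hx0 hc hz
    have := smul_vertex_injective hE (ha.symm.trans (scalar_of_connects hx hl hza))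
    rw [this, scalar_of_connects hx hl hzb]

theorem scalar_of_mem_class (hE : E.RowFinite) (hx0 : x ∈ component K E 0) {q : E.Class} {a b : V}
    (ha : a ∈ q.carrier) (hb : b ∈ q.carrier) {k : K}
    (h : x * vertex K E a = k • vertex K E a) : x * vertex K E b = k • vertex K E b := by
  have hab : Relation.TransGen E.Rel₁ a b := Quotient.exact (Eq.trans ha (Eq.symm hb))
  clear hb
  induction hab with
  | single hab => exact scalar_of_rel₁ hx hE hx0 h hab
  | tail _ hab ih => exact scalar_of_rel₁ hx hE hx0 ih hab

theorem scalar_of_mem_closure (hE : E.RowFinite) (hx0 : x ∈ component K E 0) {q : E.Class}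
    {a b : V} (ha : a ∈ q.carrier) {k : K} (h : x * vertex K E a = k • vertex K E a)
    (hb : b ∈ q.closure) : x * vertex K E b = k • vertex K E b :=
  satClosure_induction (C := fun b => x * vertex K E b = k • vertex K E b)
    (fun _ hb => scalar_of_mem_class hx hE hx0 ha hb h)
    (fun _ he h => scalar_of_ranges hx hE he h) hb

/-- The class of a vertex of `P` at which a central element of degree `0` is nonzero
belongs to `X_f`. -/
theorem mk_mem_Xf (hE : E.RowFinite) (hx0 : x ∈ component K E 0) {a : V} (ha : a ∈ E.P)
    (hne : x * vertex K E a ≠ 0) : (Quotient.mk E.equiv a) ∈ E.Xf := by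
  set q : E.Class := Quotient.mk E.equiv a with hq
  have hqX : q ∈ E.X := ⟨a, ha, rfl⟩
  have haq : a ∈ q.carrier := rfl
  obtain ⟨k, hk⟩ := exists_scalar_of_tame hx hE hx0 (tame_of_mem_P ha)
  have hk0 : k ≠ 0 := fun h => hne (by rw [hk, h, zero_smul])
  have hclos : ∀ b ∈ q.closure, x * vertex K E b ≠ 0 := fun b hb => by
    rw [scalar_of_mem_closure hx hE hx0 haq hk hb]
    exact smul_ne_zero hk0 (vertex_ne_zero K hE b)
  obtain ⟨W, hW⟩ := exists_local_unit hx0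
  have hmem : ∀ b, x * vertex K E b ≠ 0 → b ∈ W := fun b hb => by
    by_contra h
    exact hb (mul_vertex_eq_zero_of_notMem hW h)
  have hfin : q.closure.Finite := W.finite_toSet.subset fun b hb => hmem b (hclos b hb)
  -- A cycle vertex above the closure is above an element of the class, hence in the class by the
  -- third clause of ∼¹.
  have hcyc : ∀ z p, p ≠ [] → E.IsPath z p z → ∀ y ∈ q.closure, E.Connects z y →
      z ∈ q.closure := by
    intro z p hp hz y hy hzy
    obtain ⟨c, hc, hzc⟩ := exists_isCycle hz hp
    obtain ⟨h, hh, hyh⟩ := exists_connects_of_mem_closure hy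
    have : E.Rel₁ h z := Or.inr (Or.inr ⟨c, hc, z, hzc, hzy.trans hyh, .refl z⟩)
    exact carrier_subset_closure q (this.mem_carrier hh)
  -- All vertices of a path in F_E connect to the closure, hence lie in `W`. Its edges have distinct
  -- sources, so its length is at most |W|, and row-finiteness leaves finitely many edges.
  have hFfin : (E.F q.closure).Finite := by
    have hS : {e : Ed | E.s e ∈ W}.Finite := by
      have : {e : Ed | E.s e ∈ W} = ⋃ v ∈ W, {e | E.s e = v} := by ext; simp
      rw [this]
      exact W.finite_toSet.biUnion fun v _ => hE v
    have hL : {l : List Ed | l.length ≤ W.card ∧ ∀ e ∈ l, e ∈ {e : Ed | E.s e ∈ W}}.Finite :=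
      have := hS.to_subtype
      ((List.finite_length_le {e : Ed | E.s e ∈ W} W.card).image (List.map Subtype.val)).subset
        fun l hl => by
          lift l to List {e : Ed | E.s e ∈ W} using hl.2
          exact ⟨l, show l.length ≤ W.card by simpa using hl.1, rfl⟩
    refine Set.Finite.of_finite_image (f := fun α : E.Path => (α.source, α.edges))
      ((W.finite_toSet.prod hL).subset ?_) ?_
    · rintro _ ⟨⟨a', p, b, hp⟩, ⟨h1, h2, h3, h4⟩, rfl⟩
      simp only at h1 h2 h3 h4 hp
      have hsrc : ∀ v, E.Connects v b → v ∈ W := fun v hv => by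
        refine hmem v fun h => hclos b h4 (mul_vertex_eq_zero_of_connects hx h hv)
      have hedge : ∀ e ∈ p, E.s e ∈ W := fun e he => by
        obtain ⟨l, m, rfl⟩ := List.append_of_mem he
        obtain ⟨y, -, hy, hm⟩ := isPath_append.1 hp
        exact hsrc _ (connects_iff.2 ⟨e :: m, rfl, hm⟩)
      refine ⟨hsrc a' (connects_iff.2 ⟨p, hp⟩), ?_, hedge⟩
      classical
      have hnd := nodup_of_mem_F hcyc hp h2 h3 h4
      rw [← List.length_map (f := E.s), ← List.toFinset_card_of_nodup hnd]
      refine Finset.card_le_card fun v hv => ?_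
      obtain ⟨e, he, rfl⟩ := List.mem_map.1 (List.mem_toFinset.1 hv)
      exact hedge e he
    · rintro ⟨a₁, p₁, b₁, h₁⟩ - ⟨a₂, p₂, b₂, h₂⟩ - h
      obtain ⟨rfl, rfl⟩ := Prod.mk.inj h
      obtain rfl := isPath_range_unique h₁ h₂
      rfl
  refine ⟨hqX, fun b hb hbq => ⟨hb, ?_, ?_⟩⟩
  · rwa [hbq]
  · rwa [hbq]

end Scalar

/-! ### The elements a_[v] are central and separate the classes -/

section ClassElement

variable {q : E.Class}

theorem classElement_eq (hH : q.closure.Finite) (hF : (E.F q.closure).Finite) :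
    classElement K q = (∑ x ∈ hH.toFinset, vertex K E x) +
      ∑ α ∈ hF.toFinset, path K α * ghostPath K α := by
  rw [classElement, finsum_mem_eq_finite_toFinset_sum _ hH,
    finsum_mem_eq_finite_toFinset_sum _ hF]

theorem finite_of_mem_Xf (hq : q ∈ E.Xf) : q.closure.Finite ∧ (E.F q.closure).Finite := by
  obtain ⟨⟨x, hx, rfl⟩, h⟩ := hq
  exact (h x hx rfl).2

theorem vertex_mul_sum (W : Finset V) [DecidablePred (· ∈ W)] (x : V) :
    vertex K E x * ∑ y ∈ W, vertex K E y = if x ∈ W then vertex K E x else 0 := by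
  rw [Finset.mul_sum]
  split_ifs with h
  · rw [Finset.sum_eq_single_of_mem x h fun y _ hy => vertex_mul_of_ne hy.symm, vertex_mul_self]
  · exact Finset.sum_eq_zero fun y hy => vertex_mul_of_ne (ne_of_mem_of_not_mem hy h).symm

theorem sum_mul_vertex (W : Finset V) [DecidablePred (· ∈ W)] (x : V) :
    (∑ y ∈ W, vertex K E y) * vertex K E x = if x ∈ W then vertex K E x else 0 := by
  rw [Finset.sum_mul]
  split_ifs with h
  · rw [Finset.sum_eq_single_of_mem x h fun y _ hy => vertex_mul_of_ne hy, vertex_mul_self]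
  · exact Finset.sum_eq_zero fun y hy => vertex_mul_of_ne (ne_of_mem_of_not_mem hy h)

theorem vertex_mul_path_of_ne {α : E.Path} {x : V} (h : α.source ≠ x) :
    vertex K E x * (path K α * ghostPath K α) = 0 := by
  rw [← mul_assoc, path_eq, vertex_mul_listPath_of_ne α.isPath h.symm, zero_mul]

theorem ghostPath_mul_vertex_of_ne {α : E.Path} {x : V} (h : α.source ≠ x) :
    path K α * ghostPath K α * vertex K E x = 0 := by
  rw [mul_assoc, ghostPath_eq, listGhost_mul_vertex_of_ne α.isPath h.symm, mul_zero]

theorem vertex_mul_path_ghostPath (α : E.Path) (x : V) :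
    vertex K E x * (path K α * ghostPath K α) = path K α * ghostPath K α * vertex K E x := by
  by_cases h : α.source = x
  · subst h
    rw [← mul_assoc, mul_assoc (path K α), path_eq, ghostPath_eq, source_mul_listPath α.isPath,
      listGhost_mul_source α.isPath]
  · rw [vertex_mul_path_of_ne h, ghostPath_mul_vertex_of_ne h]

theorem edge_mul_path_of_ne {α : E.Path} {e : Ed} (h : α.source ≠ E.r e) :
    edge K E e * (path K α * ghostPath K α) = 0 := by
  rw [← edge_mul_range, mul_assoc, vertex_mul_path_of_ne h, mul_zero]

theorem ghostPath_mul_edge_of_ne {α : E.Path} {e : Ed} (h : α.source ≠ E.s e) :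
    path K α * ghostPath K α * edge K E e = 0 := by
  rw [← source_mul_edge, ← mul_assoc, ghostPath_mul_vertex_of_ne h, zero_mul]

theorem ghostPath_mul_edge {α : E.Path} {f e : Ed} {p : List Ed} (h : α.edges = f :: p) :
    path K α * ghostPath K α * edge K E e =
      path K α * listGhost K E p α.range * (ghostEdge K E f * edge K E e) := by
  simp only [ghostPath_eq, h, listGhost_cons, mul_assoc]

theorem classElement_mul_vertex (hH : q.closure.Finite) (hF : (E.F q.closure).Finite) (x : V) :
    classElement K q * vertex K E x = vertex K E x * classElement K q := by
  classical
  rw [classElement_eq hH hF, add_mul, mul_add, sum_mul_vertex, vertex_mul_sum, Finset.mul_sum,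
    Finset.sum_mul]
  simp only [vertex_mul_path_ghostPath]

/-- Let H be the closure. If s(e) ∈ H, then r(e) ∈ H and the paths in F_E, starting outside H,
contribute nothing. If only r(e) ∈ H, the single path α = e contributes ee*e = e. If neither is in
H, the map α ↦ eα matches the paths of F_E starting at r(e) with those beginning with e, and eαα* =
(eα)(eα)*e. -/
theorem classElement_mul_edge (hq : q ∈ E.X) (hH : q.closure.Finite) (hF : (E.F q.closure).Finite)
    (e : Ed) : classElement K q * edge K E e = edge K E e * classElement K q := by
  classical
  have h1 : (∑ x ∈ hH.toFinset, vertex K E x) * edge K E e =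
      if E.s e ∈ q.closure then edge K E e else 0 := by
    rw [← source_mul_edge, ← mul_assoc, sum_mul_vertex, ite_mul, zero_mul]
    simp [source_mul_edge]
  have h2 : edge K E e * (∑ x ∈ hH.toFinset, vertex K E x) =
      if E.r e ∈ q.closure then edge K E e else 0 := by
    rw [← edge_mul_range, mul_assoc, vertex_mul_sum, mul_ite, mul_zero]
    simp [edge_mul_range]
  rw [classElement_eq hH hF, add_mul, mul_add, h1, h2, Finset.mul_sum, Finset.sum_mul]
  by_cases hs : E.s e ∈ q.closure
  · have hr := closure_hereditary hq e hs
    rw [if_pos hs, if_pos hr, Finset.sum_eq_zero, Finset.sum_eq_zero]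
    · intro α hα
      have hα := (hF.mem_toFinset.1 hα).2.1
      exact edge_mul_path_of_ne fun h => hα (h ▸ hr)
    · intro α hα
      have hα := (hF.mem_toFinset.1 hα).2.1
      exact ghostPath_mul_edge_of_ne fun h => hα (h ▸ hs)
  rw [if_neg hs, zero_add]
  by_cases hr : E.r e ∈ q.closure
  · have hmem : Path.cons e ⟨E.r e, [], E.r e, rfl⟩ rfl ∈ hF.toFinset := by
      rw [hF.mem_toFinset]
      exact ⟨List.cons_ne_nil _ _, hs, fun _ h => (List.not_mem_nil h).elim, hr⟩
    rw [if_pos hr, Finset.sum_eq_single_of_mem _ hmem, Finset.sum_eq_zero, add_zero]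
    · rw [ghostPath_mul_edge rfl, ghostEdge_mul_edge, path_eq]
      simp only [DirectedGraph.Path.cons, listPath_cons, listPath_nil, listGhost_nil,
        edge_mul_range]
    · intro α hα
      have hα := (hF.mem_toFinset.1 hα).2.1
      exact edge_mul_path_of_ne fun h => hα (h ▸ hr)
    · rintro ⟨a, _ | ⟨f, p⟩, b, h⟩ hα hne
      · exact ((hF.mem_toFinset.1 hα).1 rfl).elim
      · rw [ghostPath_mul_edge rfl, ghostEdge_mul_edge_of_ne, mul_zero]
        rintro rfl
        have hα := (hF.mem_toFinset.1 hα).2.2.1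
        cases p with
        | nil => exact hne (by obtain ⟨rfl, rfl⟩ := h; rfl)
        -- A longer path beginning with this edge would enter H before its end.
        | cons g p => exact hα f (by simp) hr
  · rw [if_neg hr, zero_add]
    symm
    rw [← Finset.sum_filter_of_ne (p := fun α : E.Path => α.source = E.r e)
        fun α _ h => by_contra fun h' => h (edge_mul_path_of_ne h'),
      ← Finset.sum_filter_of_ne (s := hF.toFinset)
        (f := fun α : E.Path => path K α * ghostPath K α * edge K E e)
        (p := fun α : E.Path => α.edges.head? = some e)]
    · refine Finset.sum_bij (fun α hα => Path.cons e α (Finset.mem_filter.1 hα).2) ?_ ?_ ?_ ?_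
      · intro α hα
        obtain ⟨hα, hα'⟩ := Finset.mem_filter.1 hα
        obtain ⟨a1, a2, a3, a4⟩ := hF.mem_toFinset.1 hα
        rw [Finset.mem_filter, hF.mem_toFinset]
        refine ⟨⟨List.cons_ne_nil _ _, hs, ?_, a4⟩, rfl⟩
        simp only [DirectedGraph.Path.cons, List.dropLast_cons_of_ne_nil a1]
        rintro f (_ | ⟨_, hf⟩)
        exacts [hr, a3 f hf]
      · intro α hα β hβ h
        have hα := (Finset.mem_filter.1 hα).2
        have hβ := (Finset.mem_filter.1 hβ).2
        have hr := congrArg DirectedGraph.Path.range h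
        exact DirectedGraph.Path.ext (hα.trans hβ.symm)
          (List.cons.inj (congrArg DirectedGraph.Path.edges h)).2 hr
      · rintro ⟨a, _ | ⟨f, p⟩, b, h⟩ hα
        · simp at hα
        · obtain ⟨hα1, hα'⟩ := Finset.mem_filter.1 hα
          obtain rfl : f = e := by simpa using hα'
          obtain ⟨rfl, h⟩ := h
          obtain ⟨a1, a2, a3, a4⟩ := hF.mem_toFinset.1 hα1
          have hp : p ≠ [] := by
            rintro rfl
            exact hr (by obtain rfl : E.r f = b := h; exact a4)
          simp only [List.dropLast_cons_of_ne_nil hp] at a3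
          refine ⟨⟨E.r f, p, b, h⟩, ?_, rfl⟩
          rw [Finset.mem_filter, hF.mem_toFinset]
          exact ⟨⟨hp, hr, fun g hg => a3 g (by simp [hg]), a4⟩, rfl⟩
      · intro α hα
        have hα := (Finset.mem_filter.1 hα).2
        rw [ghostPath_mul_edge rfl, ghostEdge_mul_edge, mul_assoc]
        have h : listGhost K E α.edges α.range * vertex K E (E.r e) =
            listGhost K E α.edges α.range := hα ▸ listGhost_mul_source α.isPath
        change _ = path K _ * (listGhost K E α.edges α.range * _)
        rw [h, path_eq, path_eq, ghostPath_eq, ← mul_assoc]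
        rfl
    · rintro ⟨a, _ | ⟨f, p⟩, b, h⟩ hα hne
      · exact ((hF.mem_toFinset.1 hα).1 rfl).elim
      · by_contra hfe
        refine hne ?_
        rw [ghostPath_mul_edge rfl, ghostEdge_mul_edge_of_ne (by simpa using hfe), mul_zero]

/-- Insert (CK2) at s(e): e*a is the sum of the e*f a f*, and (CK1) leaves only f = e. -/
theorem mul_ghostEdge_of_commute (hE : E.RowFinite) {a : LeavittPathAlgebra K E}
    (hv : ∀ x, a * vertex K E x = vertex K E x * a) (he : ∀ e, a * edge K E e = edge K E e * a)
    (e : Ed) : a * ghostEdge K E e = ghostEdge K E e * a := by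
  have hS : ∀ f, f ∈ (hE (E.s e)).toFinset ↔ E.s f = E.s e := fun f => by simp
  have hmem : e ∈ (hE (E.s e)).toFinset := (hS e).2 rfl
  symm
  calc ghostEdge K E e * a
      = ghostEdge K E e * (a * vertex K E (E.s e)) := by
        rw [hv, ← mul_assoc, ghostEdge_mul_source]
    _ = ∑ f ∈ (hE (E.s e)).toFinset, ghostEdge K E e * edge K E f * (a * ghostEdge K E f) := by
        rw [← sum_edge_mul_ghostEdge hS ⟨e, hmem⟩, Finset.mul_sum, Finset.mul_sum]
        refine Finset.sum_congr rfl fun f _ => ?_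
        rw [← mul_assoc a, he]
        simp only [mul_assoc]
    _ = vertex K E (E.r e) * (a * ghostEdge K E e) := by
        rw [Finset.sum_eq_single_of_mem e hmem, ghostEdge_mul_edge]
        intro f _ hf
        rw [ghostEdge_mul_edge_of_ne hf.symm, zero_mul]
    _ = a * ghostEdge K E e := by rw [← mul_assoc, ← hv, mul_assoc, range_mul_ghostEdge]

theorem classElement_mem_centerComponent (hE : E.RowFinite) (hq : q ∈ E.Xf) :
    classElement K q ∈ centerComponent K E 0 := by
  obtain ⟨hH, hF⟩ := finite_of_mem_Xf hq
  refine ⟨?_, ?_⟩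
  · have hv := classElement_mul_vertex (K := K) hH hF
    have he := classElement_mul_edge (K := K) hq.1 hH hF
    exact mem_center_of_commute hv he (mul_ghostEdge_of_commute hE hv he)
  · rw [classElement_eq hH hF]
    refine add_mem (sum_mem fun x _ => ?_) (sum_mem fun α _ => ?_)
    · refine Submodule.subset_span ⟨⟨x, [], x, rfl⟩, ⟨x, [], x, rfl⟩, by simp, ?_⟩
      exact (vertex_mul_self x).symm
    · exact Submodule.subset_span ⟨α, α, by simp, rfl⟩

theorem classElement_mul_vertex_of_mem (hq : q ∈ E.Xf) {x : V} (hx : x ∈ q.carrier) :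
    classElement K q * vertex K E x = vertex K E x := by
  classical
  obtain ⟨hH, hF⟩ := finite_of_mem_Xf hq
  have hxH := carrier_subset_closure q hx
  rw [classElement_eq hH hF, add_mul, sum_mul_vertex, if_pos (hH.mem_toFinset.2 hxH),
    Finset.sum_mul, Finset.sum_eq_zero, add_zero]
  intro α hα
  exact ghostPath_mul_vertex_of_ne fun h => (hF.mem_toFinset.1 hα).2.1 (h ▸ hxH)

theorem classElement_mul_vertex_of_ne {q' : E.Class} (hq : q ∈ E.Xf) (hq' : q' ∈ E.X)
    (hne : q ≠ q') {x : V} (hx : x ∈ q'.carrier) : classElement K q * vertex K E x = 0 := by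
  classical
  obtain ⟨hH, hF⟩ := finite_of_mem_Xf hq
  have hxH : x ∉ q.closure := not_connects_closure hq' hne hx (.refl x)
  rw [classElement_eq hH hF, add_mul, sum_mul_vertex, if_neg (by simpa using hxH),
    Finset.sum_mul, Finset.sum_eq_zero, add_zero]
  intro α hα
  exact ghostPath_mul_vertex_of_ne fun h =>
    not_connects_closure hq' hne hx ⟨α, h, rfl⟩ (hF.mem_toFinset.1 hα).2.2.2

end ClassElement

/-! ### Linear independence and spanning -/

theorem mem_centerComponent_zero {x : LeavittPathAlgebra K E} (hx : x ∈ centerComponent K E 0) :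
    (∀ b, b * x = x * b) ∧ x ∈ component K E 0 :=
  ⟨(NonUnitalSubalgebra.mem_center_iff (R := K)).1 hx.1, hx.2⟩

/-- A central element of degree `0` that annihilates `P` is zero. -/
theorem eq_zero_of_mul_P (hE : E.RowFinite) {x : LeavittPathAlgebra K E}
    (hx : x ∈ centerComponent K E 0) (h : ∀ a ∈ E.P, x * vertex K E a = 0) : x = 0 := by
  obtain ⟨hx, hx0⟩ := mem_centerComponent_zero hx
  obtain ⟨N, hN⟩ := exists_scalar_of_long hx hx0
  obtain ⟨W, hW⟩ := exists_local_unit hx0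
  refine eq_zero_of_long hx hE hx0 (N := N) fun a p b hp hb => ?_
  obtain ⟨k, hk⟩ := hN a p b hp hb
  by_contra hne
  have hk0 : k ≠ 0 := fun h => hne (by rw [hk, h, zero_smul])
  have hT : ∀ c ∈ E.tree b, x * vertex K E c ≠ 0 := fun c hc => by
    rw [scalar_of_connects hx hk hc]
    exact smul_ne_zero hk0 (vertex_ne_zero K hE c)
  have hfin : (E.tree b).Finite := W.finite_toSet.subset fun c hc => by
    by_contra hcW
    exact hT c hc (mul_vertex_eq_zero_of_notMem hW hcW)
  obtain ⟨y, hy, hby⟩ := exists_mem_P hfin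
  exact hT y hby (h y hy)

variable (K E) in
/-- The family of the elements `a_q` in the zero component of the center. -/
def classFamily (hE : E.RowFinite) (q : E.Xf) : centerComponent K E 0 :=
  ⟨classElement K (q : E.Class), classElement_mem_centerComponent hE q.2⟩

/-- Multiplying by a vertex of a class reads off the coefficient of that class, 0 if it does not
occur; both halves of the basis property use this. -/
theorem sum_classElement_mul_vertex (S : Finset E.Xf) (g : E.Xf → K) {q : E.Class} (hq : q ∈ E.X)
    {x : V} (hx : x ∈ q.carrier) :
    (∀ h : q ∈ E.Xf, ⟨q, h⟩ ∈ S →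
      (∑ p ∈ S, g p • classElement K (p : E.Class)) * vertex K E x =
        g ⟨q, h⟩ • vertex K E x) ∧
    ((∀ h : q ∈ E.Xf, ⟨q, h⟩ ∉ S) →
      (∑ p ∈ S, g p • classElement K (p : E.Class)) * vertex K E x = 0) := by
  rw [Finset.sum_mul]
  constructor
  · intro h hS
    rw [Finset.sum_eq_single_of_mem _ hS, smul_mul_assoc, classElement_mul_vertex_of_mem h hx]
    intro p _ hp
    rw [smul_mul_assoc, classElement_mul_vertex_of_ne p.2 hq (fun h => hp (Subtype.ext h)) hx,
      smul_zero]
  · intro h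
    refine Finset.sum_eq_zero fun p hp => ?_
    rw [smul_mul_assoc, classElement_mul_vertex_of_ne p.2 hq _ hx, smul_zero]
    rintro rfl
    exact h p.2 hp

theorem linearIndependent_classFamily (hE : E.RowFinite) :
    LinearIndependent K (classFamily K E hE) := by
  rw [linearIndependent_iff']
  intro S g hg q hq
  obtain ⟨x, hx, hxq⟩ := q.2.1
  have h0 : ∑ p ∈ S, g p • classElement K (p : E.Class) = 0 := by
    simpa [classFamily] using congrArg Subtype.val hg
  have := (sum_classElement_mul_vertex S g q.2.1 (x := x) hxq).1 q.2 hq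
  rw [h0, zero_mul] at this
  exact (smul_eq_zero.1 this.symm).resolve_right (vertex_ne_zero K hE x)

theorem span_classFamily (hE : E.RowFinite) :
    ⊤ ≤ Submodule.span K (Set.range (classFamily K E hE)) := by
  rintro ⟨x, hxc⟩ -
  obtain ⟨hx, hx0⟩ := mem_centerComponent_zero hxc
  choose rep hrepP hrep using fun q : E.Xf => q.2.1
  choose g hg using fun q : E.Xf =>
    exists_scalar_of_tame hx hE hx0 (tame_of_mem_P (hrepP q))
  obtain ⟨W, hW⟩ := exists_local_unit hx0
  -- Distinct classes have distinct representatives, and those on which `x` is nonzero lie in `W`.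
  have hfin : {q : E.Xf | x * vertex K E (rep q) ≠ 0}.Finite := by
    refine Set.Finite.of_finite_image (f := rep) (W.finite_toSet.subset ?_) ?_
    · rintro _ ⟨q, hq, rfl⟩
      by_contra h
      exact hq (mul_vertex_eq_zero_of_notMem hW h)
    · intro p _ q _ h
      refine Subtype.ext ?_
      rw [← hrep p, ← hrep q, h]
  set S := hfin.toFinset with hS
  have hsum : x = ∑ p ∈ S, g p • classElement K (p : E.Class) := by
    rw [← sub_eq_zero]
    refine eq_zero_of_mul_P hE (sub_mem hxc (sum_mem fun p _ =>
      Submodule.smul_mem _ _ (classElement_mem_centerComponent hE p.2))) fun a ha => ?_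
    have hsc := sum_classElement_mul_vertex S g (q := Quotient.mk E.equiv a) ⟨a, ha, rfl⟩
      (x := a) rfl
    rw [sub_mul, sub_eq_zero]
    have hra : ∀ h : Quotient.mk E.equiv a ∈ E.Xf,
        x * vertex K E a = g ⟨_, h⟩ • vertex K E a := fun h =>
      scalar_of_mem_class hx hE hx0 (q := Quotient.mk E.equiv a) (hrep ⟨_, h⟩) rfl (hg ⟨_, h⟩)
    by_cases h0 : x * vertex K E a = 0
    · rw [h0]
      by_cases h : ∃ h : Quotient.mk E.equiv a ∈ E.Xf, ⟨_, h⟩ ∈ S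
      · obtain ⟨h, hmem⟩ := h
        rw [hsc.1 h hmem, ← hra h, h0]
      · push Not at h
        rw [hsc.2 h]
    · have h := mk_mem_Xf hx hE hx0 ha h0
      -- The same scalar serves `a` and the representative of its class, so `x` is nonzero at the
      -- representative too.
      have hmem : (⟨_, h⟩ : E.Xf) ∈ S := by
        rw [hS, hfin.mem_toFinset]
        intro h'
        refine h0 ?_
        have := hra h
        rw [hg ⟨_, h⟩, smul_eq_zero] at h'
        rw [this, h'.resolve_right (vertex_ne_zero K hE _), zero_smul]
      rw [hsc.1 h hmem, hra h]
  have : (⟨x, hxc⟩ : centerComponent K E 0) = ∑ p ∈ S, g p • classFamily K E hE p := by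
    refine Subtype.ext ?_
    simpa [classFamily] using hsum
  rw [this]
  exact sum_mem fun p _ => Submodule.smul_mem _ _ (Submodule.subset_span ⟨p, rfl⟩)

end LeavittPathAlgebra

end

/-- Pairwise distinctness is included: a basis over a field is an injective family. -/
theorem theorem3p18 {K V Ed : Type*} [Field K] (E : DirectedGraph V Ed) (hE : E.RowFinite) :
    ∃ b : Module.Basis E.Xf K (LeavittPathAlgebra.centerComponent K E 0),
      ∀ q : E.Xf, (b q : LeavittPathAlgebra K E) =
        LeavittPathAlgebra.classElement K (q : E.Class) :=
  ⟨Module.Basis.mk (LeavittPathAlgebra.linearIndependent_classFamily hE)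
    (LeavittPathAlgebra.span_classFamily hE), fun q => by
      rw [Module.Basis.mk_apply]; rfl⟩
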